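/- An $n$-component link diagram $L$ on the plane ($n\ge 0$) consists of $n$ closed immersed plane curves of class $C^1$ (the components), whose only multiple points are finitely many transverse double points (the crossing points), together with the choice, at each crossing point, of which of the two strands is the upper one; a knot diagram is a $1$-component link diagram. The regions of $L$ are the connected components of the complement of the curves in the plane. At each crossing point $C$ the curves cut a small disk around $C$ into four corners, and a region $R$ is said to appear $i$ times around $C$ if exactly $i$ of these four corners lie in $R$. The (modified) region crossing change on $R$ switches every crossing point $C$ (exchanges its upper and lower strands) $i$ times, where $i$ is the number of times that $R$ appears around $C$. A crossing point $C$ of $L$ is called admissible if a finite sequence of such region crossing changes transforms $L$ into the diagram obtained from $L$ by switching $C$ only. The incidence matrix $M_L$ is the matrix over $\mathbb{Z}_2$ with rows indexed by the regions and columns indexed by the crossing points, whose entry at $(R,C)$ is the number, modulo $2$, of times that $R$ appears around $C$. Every $n$-component link diagram $L$ on the plane has finitely many regions, and if $r$ is their number, then $\operatorname{rank}_{\mathbb{Z}_2}(M_L)=r-n-1$. In particular, every crossing point of a knot diagram on the plane is admissible. -/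

import Mathlib

open Filter Topology

/-- Parameters of the points of `n` disjoint circles `ℝ / ℤ`: the index of a circle together with
the representative of the point in `[0, 1)`. -/
abbrev LinkParam (n : ℕ) : Type := Fin n × Set.Ico (0 : ℝ) 1

/-- A projection of an `n`-component link to the plane `ℂ`: `n` closed immersed curves of class
`C¹` whose only multiple points are finitely many transverse double points. -/
structure LinkProjection (n : ℕ) where
  /-- The components, as functions of period `1`. -/
  curve : Fin n → ℝ → ℂ
  periodic : ∀ i, Function.Periodic (curve i) 1
  contDiff : ∀ i, ContDiff ℝ 1 (curve i)
  immersed : ∀ i t, deriv (curve i) t ≠ 0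
  transverse : ∀ x y : LinkParam n, x ≠ y → curve x.1 x.2 = curve y.1 y.2 →
    LinearIndependent ℝ ![deriv (curve x.1) x.2, deriv (curve y.1) y.2]
  double : ∀ x y z : LinkParam n, x ≠ y → curve x.1 x.2 = curve y.1 y.2 →
    curve z.1 z.2 = curve x.1 x.2 → z = x ∨ z = y
  finite : {p : ℂ | ∃ x y : LinkParam n, x ≠ y ∧ curve x.1 x.2 = p ∧ curve y.1 y.2 = p}.Finite

namespace LinkProjection

variable {n : ℕ} (P : LinkProjection n)

/-- The point of the plane with parameter `x`. -/
def point (x : LinkParam n) : ℂ := P.curve x.1 x.2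

/-- The tangent vector at the parameter `x`. -/
noncomputable def velocity (x : LinkParam n) : ℂ := deriv (P.curve x.1) x.2

/-- The union of all the curves. -/
def support : Set ℂ := ⋃ i, Set.range (P.curve i)

/-- The crossing points: the double points of the projection. -/
def Crossing : Type := {p : ℂ // ∃ x y : LinkParam n, x ≠ y ∧ P.point x = p ∧ P.point y = p}

instance : Finite P.Crossing := P.finite.to_subtype

noncomputable instance : Fintype P.Crossing := Fintype.ofFinite _

/-- The regions: the connected components of the complement of the projection in the plane. -/
def Region : Type := {R : Set ℂ // ∃ q ∈ P.supportᶜ, R = connectedComponentIn P.supportᶜ q}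

/-- The directions of the four corners at a crossing point: if `u` and `v` are the tangent vectors
of the two strands, these are the four vectors `± u ± v`, one in each of the four sectors. -/
def corners (c : P.Crossing) : Set ℂ :=
  {d | ∃ x y : LinkParam n, x ≠ y ∧ P.point x = c.1 ∧ P.point y = c.1 ∧
    (d = P.velocity x + P.velocity y ∨ d = P.velocity x - P.velocity y ∨
      d = -P.velocity x + P.velocity y ∨ d = -P.velocity x - P.velocity y)}

/-- The number of times that the region `R` appears around the crossing point `c`: the number of
corners at `c` (out of four) that lie in `R` near `c`. -/
noncomputable def timesAround (R : P.Region) (c : P.Crossing) : ℕ :=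
  {d ∈ P.corners c | ∀ᶠ ε : ℝ in 𝓝[>] 0, c.1 + ε • d ∈ R.1}.ncard

/-- The incidence matrix over `ℤ/2` for the modified region crossing change. Rows are regions,
columns are crossing points. -/
noncomputable def incidenceMatrix : Matrix P.Region P.Crossing (ZMod 2) :=
  Matrix.of fun R c => (P.timesAround R c : ZMod 2)

end LinkProjection

/-- An `n`-component link diagram on the plane: a projection together with the information, at each
crossing point, which of the two strands is the upper one. -/
structure LinkDiagram (n : ℕ) extends LinkProjection n where
  upper : toLinkProjection.Crossing → LinkParam n
  lower : toLinkProjection.Crossing → LinkParam n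
  upper_ne_lower : ∀ c, upper c ≠ lower c
  point_upper : ∀ c, toLinkProjection.point (upper c) = c.1
  point_lower : ∀ c, toLinkProjection.point (lower c) = c.1

namespace LinkDiagram

variable {n : ℕ}

open Classical in
/-- The diagram obtained by switching all the crossing points in `S`. -/
noncomputable def switch (L : LinkDiagram n) (S : Set L.Crossing) : LinkDiagram n where
  toLinkProjection := L.toLinkProjection
  upper c := if c ∈ S then L.lower c else L.upper c
  lower c := if c ∈ S then L.upper c else L.lower c
  upper_ne_lower c := by
    by_cases h : c ∈ S
    · simpa [h] using (L.upper_ne_lower c).symm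
    · simpa [h] using L.upper_ne_lower c
  point_upper c := by
    by_cases h : c ∈ S
    · simpa [h] using L.point_lower c
    · simpa [h] using L.point_upper c
  point_lower c := by
    by_cases h : c ∈ S
    · simpa [h] using L.point_upper c
    · simpa [h] using L.point_lower c

/-- The modified region crossing change on `R`: every crossing point around which `R` appears `i`
times is switched `i` times, which amounts to switching it exactly when `i` is odd. -/
noncomputable def regionCrossingChange (L : LinkDiagram n) (R : L.Region) : LinkDiagram n :=
  L.switch {c | Odd (L.timesAround R c)}

/-- A set `S` of crossing points is admissible if a finite sequence of region crossing changes
turns `L` into the diagram obtained from `L` by switching all the crossing points in `S`. -/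
def Admissible (L : LinkDiagram n) (S : Set L.Crossing) : Prop :=
  Relation.ReflTransGen
    (fun D D' : LinkDiagram n => ∃ R : D.Region, D' = D.regionCrossingChange R) L (L.switch S)

end LinkDiagram

/-! A vector of the left kernel of the incidence matrix is a colouring of the regions by `ZMod 2` in
which the four corners at every crossing have sum zero. Group the corners in pairs lying on opposite
sides of one half of a strand: their sum is the jump of the colouring across this strand just after
the crossing plus the jump just before it (`exists_sum_mul_timesAround`). So a colouring lies in the
left kernel exactly when its jump does not change along a strand through a crossing, that is, when
the jump is constant along each component (`jump_eq_jump`).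

Recording one jump per component gives a linear map from the left kernel to `Fin n → ZMod 2`. A
colouring without jumps is constant (`eq_of_constNear`), so the kernel of this map has dimension
one. The map is onto, because the winding number modulo two around a component jumps by one across
this component and by zero across the others. Hence the left kernel has dimension `n + 1`, and
rank-nullity gives the rank.

For a knot, a crossing cuts the curve into two closed loops. The winding number modulo two around
one of them jumps by one along this loop and by zero along the other. At the given crossing a strand
passes from one loop to the other, so the corners have sum one; at any other crossing both halves of
a strand lie in the same loop, so the sum is zero. Changing the regions of colour one therefore
switches the given crossing alone.

The jump of the winding number is computed from the integral of `dw / (w - z)`, without the Jordan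
curve theorem. The local picture comes from charts in which the curves become coordinate axes, and
finiteness of the set of regions follows from compactness of the curves. -/

/-! ### Transverse curves as coordinate axes, and local constancy along dense sets -/

/-- Linear coordinates in the plane with respect to two independent vectors. -/
theorem exists_continuousLinearEquiv_of_linearIndependent {u v : ℂ}
    (h : LinearIndependent ℝ ![u, v]) :
    ∃ A : (ℝ × ℝ) ≃L[ℝ] ℂ, ∀ x, A x = x.1 • u + x.2 • v := by
  let A : (ℝ × ℝ) →ₗ[ℝ] ℂ :=
    (LinearMap.fst ℝ ℝ ℝ).smulRight u + (LinearMap.snd ℝ ℝ ℝ).smulRight v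
  have hA : ∀ x, A x = x.1 • u + x.2 • v := fun x => by simp [A]
  have hinj : Function.Injective A := by
    rw [← LinearMap.ker_eq_bot, LinearMap.ker_eq_bot']
    intro x hx
    rw [hA] at hx
    have := LinearIndependent.pair_iff.1 h x.1 x.2 hx
    exact Prod.ext this.1 this.2
  refine ⟨(LinearEquiv.ofInjectiveOfFinrankEq A hinj ?_).toContinuousLinearEquiv, fun x => ?_⟩
  · simp [Complex.finrank_real_complex]
  · exact hA x

/-- Two transverse curves through a point are the axes of a local chart. -/
theorem exists_chart {γ δ : ℝ → ℂ} {p u v : ℂ} (hγ : HasStrictDerivAt γ u 0)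
    (hδ : HasStrictDerivAt δ v 0) (hγ0 : γ 0 = p) (hδ0 : δ 0 = p)
    (h : LinearIndependent ℝ ![u, v]) :
    ∃ e : OpenPartialHomeomorph (ℝ × ℝ) ℂ, (∀ x, e x = γ x.1 + δ x.2 - p) ∧
      (0 : ℝ × ℝ) ∈ e.source ∧ ∀ a b : ℝ,
        Tendsto (fun ε : ℝ => ε⁻¹ • e.symm (p + ε • (a • u + b • v))) (𝓝[>] 0) (𝓝 (a, b)) := by
  obtain ⟨A, hA⟩ := exists_continuousLinearEquiv_of_linearIndependent h
  have hf : HasStrictFDerivAt (fun x : ℝ × ℝ => γ x.1 + δ x.2 - p) (A : (ℝ × ℝ) →L[ℝ] ℂ) 0 := by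
    have h1 : HasStrictFDerivAt (fun x : ℝ × ℝ => γ x.1) _ 0 :=
      HasStrictFDerivAt.comp (0 : ℝ × ℝ) (f := Prod.fst) (g := γ) hγ.hasStrictFDerivAt
        hasStrictFDerivAt_fst
    have h2 : HasStrictFDerivAt (fun x : ℝ × ℝ => δ x.2) _ 0 :=
      HasStrictFDerivAt.comp (0 : ℝ × ℝ) (f := Prod.snd) (g := δ) hδ.hasStrictFDerivAt
        hasStrictFDerivAt_snd
    refine ((h1.add h2).sub_const p).congr_fderiv ?_
    ext <;> simp [hA]
  refine ⟨hf.toOpenPartialHomeomorph _, fun x => rfl, hf.mem_toOpenPartialHomeomorph_source, ?_⟩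
  intro a b
  have hp : γ (0 : ℝ × ℝ).1 + δ (0 : ℝ × ℝ).2 - p = p := by simp [hγ0, hδ0]
  have hinv := hf.to_localInverse
  have hinv' := hinv.hasFDerivAt
  rw [hp] at hinv'
  have h0 : hf.localInverse _ _ _ p = 0 := by
    have := hf.localInverse_apply_image
    simp only [hp] at this
    exact this
  have hline : HasDerivAt (fun ε : ℝ => p + ε • (a • u + b • v)) (a • u + b • v) 0 := by
    simpa using ((hasDerivAt_id (0 : ℝ)).smul_const (a • u + b • v)).const_add p
  have hcomp := HasFDerivAt.comp_hasDerivAt (0 : ℝ) (l := hf.localInverse _ _ _)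
    (f := fun ε : ℝ => p + ε • (a • u + b • v)) (by simpa using hinv') hline
  have hAs : A.symm (a • u + b • v) = (a, b) := by
    rw [ContinuousLinearEquiv.symm_apply_eq, hA]
  have := hcomp.tendsto_slope_zero_right
  simp only [ContinuousLinearEquiv.coe_coe, hAs] at this
  refine this.congr fun ε => ?_
  simp only [zero_add, Function.comp, zero_smul, add_zero, h0, sub_zero]
  rfl

/-- A function that is locally constant along a dense subset of a connected space, near every point
of the space, is constant on this subset. -/
theorem eq_of_eventually_const {X β : Type*} [TopologicalSpace X] [PreconnectedSpace X] {D : Set X}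
    (hD : ∀ x, (𝓝[D] x).NeBot) {g : X → β} (hg : ∀ x, ∃ k, ∀ᶠ y in 𝓝[D] x, g y = k) {x y : X}
    (hx : x ∈ D) (hy : y ∈ D) : g x = g y := by
  choose k hk using hg
  -- `k` extends `g` from `D` to the whole space. The values `k x` and `k y` agree for `y` near `x`,
  -- since points of `D` close to `y` are also close to `x`.
  have hloc : IsLocallyConstant k := by
    rw [IsLocallyConstant.iff_eventually_eq]
    intro x
    have := hk x
    rw [eventually_nhdsWithin_iff] at this
    filter_upwards [eventually_eventually_nhds.2 this] with y hy
    have := hD y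
    obtain ⟨z, hz1, hz2⟩ := ((hk y).and (eventually_nhdsWithin_iff.2 hy)).exists
    rw [← hz1, hz2]
  have hgk : ∀ z ∈ D, g z = k z := fun z hz => (hk z).self_of_nhdsWithin hz
  rw [hgk x hx, hgk y hy]
  exact hloc.apply_eq_of_isPreconnected isPreconnected_univ trivial trivial

/-! ### Parameters, compactness and double points -/

namespace LinkProjection

variable {n : ℕ} (P : LinkProjection n)

theorem continuous_curve (i : Fin n) : Continuous (P.curve i) := (P.contDiff i).continuous

theorem hasStrictDerivAt_curve (i : Fin n) (t : ℝ) :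
    HasStrictDerivAt (P.curve i) (deriv (P.curve i) t) t :=
  (P.contDiff i).contDiffAt.hasStrictDerivAt one_ne_zero

theorem curve_add_intCast (i : Fin n) (t : ℝ) (m : ℤ) : P.curve i (t + m) = P.curve i t := by
  simpa using (P.periodic i).int_mul m t

theorem curve_fract (i : Fin n) (t : ℝ) : P.curve i (Int.fract t) = P.curve i t := by
  simpa using (P.periodic i).sub_int_mul_eq (x := t) ⌊t⌋

theorem curve_fract_add (i : Fin n) (t a : ℝ) :
    P.curve i (Int.fract t + a) = P.curve i (t + a) := by
  rw [← P.curve_add_intCast i _ ⌊t⌋]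
  congr 1
  have := Int.fract_add_floor t
  linarith

/-- The parameter of the point `curve i t`. -/
noncomputable def param (_P : LinkProjection n) (i : Fin n) (t : ℝ) : LinkParam n :=
  (i, ⟨Int.fract t, Set.mem_Ico.2 ⟨Int.fract_nonneg t, Int.fract_lt_one t⟩⟩)

theorem point_param (i : Fin n) (t : ℝ) : P.point (P.param i t) = P.curve i t :=
  P.curve_fract i t

theorem point_mem_support (x : LinkParam n) : P.point x ∈ P.support :=
  Set.mem_iUnion.2 ⟨x.1, x.2, rfl⟩

theorem curve_mem_support (i : Fin n) (t : ℝ) : P.curve i t ∈ P.support :=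
  Set.mem_iUnion.2 ⟨i, t, rfl⟩

theorem param_eq_iff {i j : Fin n} {t s : ℝ} :
    P.param i t = P.param j s ↔ i = j ∧ ∃ m : ℤ, s = t + m := by
  rw [param, param, Prod.mk.injEq, Subtype.ext_iff]
  refine and_congr_right fun _ => ?_
  rw [eq_comm, Int.fract_eq_fract]
  exact exists_congr fun m => by constructor <;> intro h <;> linarith

theorem range_curve (i : Fin n) : Set.range (P.curve i) = P.curve i '' Set.Icc 0 1 := by
  refine Set.Subset.antisymm ?_ (Set.image_subset_range _ _)
  rintro _ ⟨t, rfl⟩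
  exact ⟨Int.fract t, ⟨Int.fract_nonneg t, (Int.fract_lt_one t).le⟩, P.curve_fract i t⟩

theorem isCompact_support : IsCompact P.support := by
  refine isCompact_iUnion fun i => ?_
  rw [range_curve]
  exact isCompact_Icc.image (P.continuous_curve i)

theorem isOpen_compl_support : IsOpen P.supportᶜ := P.isCompact_support.isClosed.isOpen_compl

/-- Near a point `p`, the curves only pass at parameters close to the parameters of `p`. -/
theorem eventually_exists_abs_sub_lt (p : ℂ) {ρ : ℝ} (hρ : 0 < ρ) :
    ∀ᶠ q in 𝓝 p, ∀ i s, P.curve i s = q → ∃ t, P.curve i t = p ∧ |s - t| < ρ := by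
  refine eventually_all.2 fun i => ?_
  -- The parameters of one period at distance at least `ρ` from all real parameters of `p`: the
  -- image of this compact set is closed and misses `p`.
  let K : Set ℝ := Set.Icc 0 1 ∩ ⋂ t ∈ {t | P.curve i t = p}, {s | ρ ≤ |s - t|}
  have hK : IsCompact K := isCompact_Icc.inter_right <| isClosed_biInter fun t _ =>
    isClosed_le continuous_const (by fun_prop)
  have hp : p ∉ P.curve i '' K := by
    rintro ⟨s, ⟨-, hs⟩, hsp⟩
    have := Set.mem_iInter₂.1 hs s hsp
    simp only [Set.mem_ofPred_eq, sub_self, abs_zero] at this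
    linarith
  have hopen : IsOpen (P.curve i '' K)ᶜ :=
    (hK.image (P.continuous_curve i)).isClosed.isOpen_compl
  filter_upwards [hopen.mem_nhds hp] with q hq s hs
  by_contra! hcon
  refine hq ⟨Int.fract s, ⟨⟨Int.fract_nonneg s, (Int.fract_lt_one s).le⟩, ?_⟩, ?_⟩
  · refine Set.mem_iInter₂.2 fun t ht => ?_
    have := hcon (t + ⌊s⌋) (by rw [P.curve_add_intCast]; exact ht)
    have h2 : s - (t + ⌊s⌋) = Int.fract s - t := by rw [Int.fract]; ring
    rwa [h2] at this
  · rw [P.curve_fract, hs]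

/-- The double points of the projection. -/
def doublePoints : Set ℂ := {p : ℂ | ∃ x y : LinkParam n, x ≠ y ∧ P.point x = p ∧ P.point y = p}

theorem finite_doublePoints : P.doublePoints.Finite := P.finite

/-- The other double points are finitely many, hence keep away from the given point, and a curve
with nonzero velocity leaves this point at once. -/
theorem eventually_notMem_doublePoints (i : Fin n) (t : ℝ) :
    ∀ᶠ s in 𝓝[≠] t, P.curve i s ∉ P.doublePoints := by
  have h1 : ∀ᶠ s in 𝓝[≠] t, P.curve i s ∉ P.doublePoints \ {P.curve i t} := by
    refine eventually_nhdsWithin_of_eventually_nhds ?_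
    have hmem : (P.doublePoints \ {P.curve i t})ᶜ ∈ 𝓝 (P.curve i t) :=
      ((P.finite_doublePoints.subset Set.sdiff_subset).isClosed.isOpen_compl).mem_nhds (by simp)
    exact (P.continuous_curve i).continuousAt.eventually hmem
  have h2 : ∀ᶠ s in 𝓝[≠] t, P.curve i s ≠ P.curve i t :=
    (P.hasStrictDerivAt_curve i t).hasDerivAt.eventually_ne (P.immersed i t)
  filter_upwards [h1, h2] with s hs1 hs2 hs3
  exact hs1 ⟨hs3, hs2⟩

/-- The function `F` is constant on the regions. -/
def ConstOnRegions {α : Type*} (F : ℂ → α) : Prop :=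
  ∀ A ⊆ P.supportᶜ, IsPreconnected A → ∀ x ∈ A, ∀ y ∈ A, F x = F y

/-- The function `F` is constant outside of the curves near the point `p`. -/
def ConstNear {α : Type*} (F : ℂ → α) (p : ℂ) : Prop :=
  ∃ k, ∀ᶠ q in 𝓝[P.supportᶜ] p, F q = k

variable {P}

/-- In a chart in which the curves are the first axis, a function is constant near a point of this
axis when it has the same value on both sides. -/
theorem constNear_iff_of_chart {α : Type*} {F : ℂ → α} (hF : P.ConstOnRegions F)
    {e : OpenPartialHomeomorph (ℝ × ℝ) ℂ} {I : Set ℝ} {r : ℝ} (hI : IsOpen I) (hIc : Convex ℝ I)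
    (he : I ×ˢ Set.Ioo (-r) r ⊆ e.source)
    (hS : ∀ x ∈ I ×ˢ Set.Ioo (-r) r, e x ∈ P.support ↔ x.2 = 0)
    {a₀ a₁ a₂ b₁ b₂ : ℝ} (h₀ : a₀ ∈ I) (h₁ : a₁ ∈ I) (h₂ : a₂ ∈ I) (hb₁ : b₁ ∈ Set.Ioo 0 r)
    (hb₂ : b₂ ∈ Set.Ioo (-r) 0) :
    P.ConstNear F (e (a₀, 0)) ↔ F (e (a₁, b₁)) = F (e (a₂, b₂)) := by
  have hr : 0 < r := hb₁.1.trans hb₁.2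
  have sub1 : I ×ˢ Set.Ioo 0 r ⊆ I ×ˢ Set.Ioo (-r) r :=
    Set.prod_mono_right (Set.Ioo_subset_Ioo_left (by linarith))
  have sub2 : I ×ˢ Set.Ioo (-r) 0 ⊆ I ×ˢ Set.Ioo (-r) r :=
    Set.prod_mono_right (Set.Ioo_subset_Ioo_right (by linarith))
  -- A half box is convex and its image misses the curves, so `F` takes a single value on it.
  have const1 : ∀ x ∈ I ×ˢ Set.Ioo 0 r, F (e x) = F (e (a₁, b₁)) := fun x hx => by
    refine hF (e '' (I ×ˢ Set.Ioo 0 r)) ?_ ?_ _ ⟨x, hx, rfl⟩ _ ⟨_, ⟨h₁, hb₁⟩, rfl⟩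
    · rintro _ ⟨y, hy, rfl⟩ hyS
      exact hy.2.1.ne' ((hS y (sub1 hy)).1 hyS)
    · exact (hIc.prod (convex_Ioo 0 r)).isPreconnected.image _
        (e.continuousOn.mono (sub1.trans he))
  have const2 : ∀ x ∈ I ×ˢ Set.Ioo (-r) 0, F (e x) = F (e (a₂, b₂)) := fun x hx => by
    refine hF (e '' (I ×ˢ Set.Ioo (-r) 0)) ?_ ?_ _ ⟨x, hx, rfl⟩ _ ⟨_, ⟨h₂, hb₂⟩, rfl⟩
    · rintro _ ⟨y, hy, rfl⟩ hyS
      exact hy.2.2.ne ((hS y (sub2 hy)).1 hyS)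
    · exact (hIc.prod (convex_Ioo (-r) 0)).isPreconnected.image _
        (e.continuousOn.mono (sub2.trans he))
  have mem0 : ((a₀, 0) : ℝ × ℝ) ∈ I ×ˢ Set.Ioo (-r) r := ⟨h₀, by simp [hr]⟩
  constructor
  · rintro ⟨k, hk⟩
    rw [eventually_nhdsWithin_iff] at hk
    have hk' : ∀ᶠ x in 𝓝 ((a₀, 0) : ℝ × ℝ), e x ∈ P.supportᶜ → F (e x) = k :=
      (e.continuousAt (he mem0)).eventually hk
    have htend : Tendsto (fun b : ℝ => ((a₀, b) : ℝ × ℝ)) (𝓝 0) (𝓝 (a₀, 0)) :=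
      Continuous.tendsto (by fun_prop : Continuous fun b : ℝ => ((a₀, b) : ℝ × ℝ)) 0
    have hkb := htend.eventually hk'
    have e1 : F (e (a₁, b₁)) = k := by
      obtain ⟨b, hb, hb'⟩ := ((eventually_nhdsWithin_of_eventually_nhds hkb).and
        (Ioo_mem_nhdsGT hr)).exists
      have hm : ((a₀, b) : ℝ × ℝ) ∈ I ×ˢ Set.Ioo 0 r := ⟨h₀, hb'⟩
      rw [← const1 _ hm]
      exact hb fun hS' => hb'.1.ne' ((hS _ (sub1 hm)).1 hS')
    have e2 : F (e (a₂, b₂)) = k := by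
      obtain ⟨b, hb, hb'⟩ := ((eventually_nhdsWithin_of_eventually_nhds hkb).and
        (Ioo_mem_nhdsLT (neg_lt_zero.2 hr))).exists
      have hm : ((a₀, b) : ℝ × ℝ) ∈ I ×ˢ Set.Ioo (-r) 0 := ⟨h₀, hb'⟩
      rw [← const2 _ hm]
      exact hb fun hS' => hb'.2.ne ((hS _ (sub2 hm)).1 hS')
    rw [e1, e2]
  · intro heq
    refine ⟨F (e (a₁, b₁)), eventually_nhdsWithin_iff.2 ?_⟩
    have hopen : IsOpen (e '' (I ×ˢ Set.Ioo (-r) r)) :=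
      e.isOpen_image_of_subset_source (hI.prod isOpen_Ioo) he
    filter_upwards [hopen.mem_nhds ⟨_, mem0, rfl⟩]
    rintro _ ⟨x, hx, rfl⟩ hxS
    have hx2 : x.2 ≠ 0 := fun h => hxS ((hS x hx).2 h)
    rcases lt_or_gt_of_ne hx2 with h | h
    · rw [heq]; exact const2 x ⟨hx.1, hx.2.1, h⟩
    · exact const1 x ⟨hx.1, h, hx.2.2⟩

end LinkProjection

/-! ### Charts at regular points and at crossings -/

/-- If a set near `p` lies on the two axes (or, when `Q` fails, on the first axis) of a chart, it
lies on these axes in a box of the chart. -/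
theorem exists_box_of_chart {γ δ : ℝ → ℂ} {p : ℂ} {S : Set ℂ} {Q : Prop}
    {e : OpenPartialHomeomorph (ℝ × ℝ) ℂ} (he : ∀ x, e x = γ x.1 + δ x.2 - p)
    (h0 : (0 : ℝ × ℝ) ∈ e.source) (hγ0 : γ 0 = p) (hδ0 : δ 0 = p)
    (hS : ∀ ρ > 0, ∀ᶠ q in 𝓝 p, q ∈ S → ∃ a : ℝ, |a| < ρ ∧ (q = γ a ∨ Q ∧ q = δ a)) :
    ∃ r > 0, Set.Ioo (-r) r ×ˢ Set.Ioo (-r) r ⊆ e.source ∧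
      ∀ x ∈ Set.Ioo (-r) r ×ˢ Set.Ioo (-r) r, e x ∈ S → x.2 = 0 ∨ Q ∧ x.1 = 0 := by
  have box : ∀ {N : Set (ℝ × ℝ)}, N ∈ 𝓝 (0 : ℝ × ℝ) →
      ∃ r > 0, Set.Ioo (-r) r ×ˢ Set.Ioo (-r) r ⊆ N := by
    intro N hN
    obtain ⟨r, hr, hrN⟩ := Metric.mem_nhds_iff.1 hN
    refine ⟨r, hr, fun x hx => hrN ?_⟩
    rw [← Prod.mk_zero_zero, ← ball_prod_same, Real.ball_eq_Ioo, zero_sub, zero_add]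
    exact hx
  obtain ⟨ρ, hρ, hρs⟩ := box (e.open_source.mem_nhds h0)
  have he0 : e 0 = p := by simp [he, hγ0, hδ0]
  -- Two boxes are needed: `ρ` keeps the axis points `(a, 0)` and `(0, a)` in the source, where `e`
  -- is injective, and the smaller `r` forces `|a| < ρ`.
  have hSρ := hS ρ hρ
  rw [← he0] at hSρ
  obtain ⟨r, hr, hrN⟩ := box (Filter.inter_mem (e.open_source.mem_nhds h0)
    ((e.continuousAt h0).eventually hSρ))
  refine ⟨r, hr, fun x hx => (hrN hx).1, fun x hx hxS => ?_⟩
  obtain ⟨a, ha, ha'⟩ := (hrN hx).2 hxS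
  rw [abs_lt] at ha
  rcases ha' with ha' | ⟨hQ, ha'⟩
  · left
    have h1 : ((a, 0) : ℝ × ℝ) ∈ e.source := hρs ⟨ha, by simp [hρ]⟩
    have h2 : e x = e (a, 0) := by simp [ha', he (a, 0), hδ0]
    rw [e.injOn (hrN hx).1 h1 h2]
  · right
    have h1 : ((0, a) : ℝ × ℝ) ∈ e.source := hρs ⟨by simp [hρ], ha⟩
    have h2 : e x = e (0, a) := by simp [ha', he (0, a), hγ0]
    rw [e.injOn (hrN hx).1 h1 h2]
    exact ⟨hQ, rfl⟩

namespace LinkProjection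

variable {n : ℕ} {P : LinkProjection n}

theorem param_eq_of_curve_eq {i j : Fin n} {t s : ℝ} (h : P.curve i t ∉ P.doublePoints)
    (hs : P.curve j s = P.curve i t) : P.param j s = P.param i t := by
  by_contra hne
  exact h ⟨_, _, hne, by rw [point_param, hs], by rw [point_param]⟩

theorem param_eq_or_of_curve_eq {x y : LinkParam n} {c : ℂ} (hxy : x ≠ y) (hx : P.point x = c)
    (hy : P.point y = c) {j : Fin n} {s : ℝ} (hs : P.curve j s = c) :
    P.param j s = x ∨ P.param j s = y := by
  refine P.double x y _ hxy (hx.trans hy.symm) ?_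
  change P.point (P.param j s) = P.point x
  rw [P.point_param, hs, hx]

theorem curve_eq_of_param_eq {x : LinkParam n} {j : Fin n} {t : ℝ} (h : P.param j t = x) (s : ℝ) :
    P.curve j s = P.curve x.1 (x.2 + (s - t)) := by
  subst h
  change _ = P.curve j (Int.fract t + (s - t))
  rw [curve_fract_add]
  congr 1
  ring

theorem hasStrictDerivAt_curve_add (P : LinkProjection n) (i : Fin n) (t : ℝ) :
    HasStrictDerivAt (fun a => P.curve i (t + a)) (deriv (P.curve i) t) 0 := by
  have := P.hasStrictDerivAt_curve i (t + 0)
  have h2 : HasStrictDerivAt (fun a : ℝ => t + a) 1 0 := (hasStrictDerivAt_id (0 : ℝ)).const_add t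
  simpa [Function.comp_def] using HasStrictDerivAt.scomp (0 : ℝ) this h2

theorem linearIndependent_I_mul {u : ℂ} (hu : u ≠ 0) :
    LinearIndependent ℝ ![u, Complex.I * u] := by
  rw [LinearIndependent.pair_iff]
  intro a b hab
  have h : ((a : ℂ) + b * Complex.I) * u = 0 := by
    rw [Complex.real_smul, Complex.real_smul] at hab
    linear_combination hab
  have h2 := (mul_eq_zero.1 h).resolve_right hu
  exact ⟨by simpa using congrArg Complex.re h2, by simpa using congrArg Complex.im h2⟩

/-- A chart at a regular point of the projection in which the curves are the first axis. -/
theorem exists_chart_regular {i : Fin n} {t : ℝ} (h : P.curve i t ∉ P.doublePoints) :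
    ∃ e : OpenPartialHomeomorph (ℝ × ℝ) ℂ, ∃ r > 0,
      Set.Ioo (-r) r ×ˢ Set.Ioo (-r) r ⊆ e.source ∧
      (∀ x ∈ Set.Ioo (-r) r ×ˢ Set.Ioo (-r) r, e x ∈ P.support ↔ x.2 = 0) ∧
      ∀ a b, e (a, b) = P.curve i (t + a) + b • (Complex.I * deriv (P.curve i) t) := by
  set u := deriv (P.curve i) t with hu
  -- The straight normal line serves as the second axis, so that the vertical coordinate of the
  -- chart measures displacement along the normal.
  have hδ : HasStrictDerivAt (fun b : ℝ => P.curve i t + b • (Complex.I * u)) (Complex.I * u) 0 := by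
    simpa using ((hasStrictDerivAt_id (0 : ℝ)).smul_const (Complex.I * u)).const_add (P.curve i t)
  obtain ⟨e, he, h0, -⟩ := exists_chart (P.hasStrictDerivAt_curve_add i t) hδ
    (p := P.curve i t) (by simp) (by simp) (linearIndependent_I_mul (P.immersed i t))
  obtain ⟨r, hr, hrs, hrS⟩ := exists_box_of_chart (S := P.support) (Q := False)
    (γ := fun a => P.curve i (t + a)) (δ := fun b : ℝ => P.curve i t + b • (Complex.I * u)) he h0
    (by simp) (by simp) fun ρ hρ => by
      filter_upwards [P.eventually_exists_abs_sub_lt (P.curve i t) hρ] with q hq hqS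
      obtain ⟨j, s, hs⟩ := Set.mem_iUnion.1 hqS
      obtain ⟨s', hs', hlt⟩ := hq j s hs
      refine ⟨s - s', hlt, Or.inl ?_⟩
      rw [← hs, curve_eq_of_param_eq (param_eq_of_curve_eq h hs')]
      exact P.curve_fract_add i t _
  have he' : ∀ a b, e (a, b) = P.curve i (t + a) + b • (Complex.I * u) := fun a b => by
    rw [he]
    simp only
    ring
  refine ⟨e, r, hr, hrs, fun x hx => ⟨fun hxS => ?_, fun hx2 => ?_⟩, he'⟩
  · simpa using hrS x hx hxS
  · have : x = (x.1, 0) := Prod.ext rfl hx2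
    rw [this, he', zero_smul, add_zero]
    exact P.curve_mem_support i _

/-- The four corners at a crossing point, and the values of a function on them. -/
theorem exists_corner_values {α : Type*} {F : ℂ → α} (hF : P.ConstOnRegions F)
    {x y : LinkParam n} {c : ℂ} (hxy : x ≠ y) (hx : P.point x = c) (hy : P.point y = c) :
    ∃ k₁ k₂ k₃ k₄ : α,
      (∀ᶠ ε : ℝ in 𝓝[>] 0, c + ε • (P.velocity x + P.velocity y) ∈ P.supportᶜ ∧
        F (c + ε • (P.velocity x + P.velocity y)) = k₁) ∧
      (∀ᶠ ε : ℝ in 𝓝[>] 0, c + ε • (P.velocity x - P.velocity y) ∈ P.supportᶜ ∧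
        F (c + ε • (P.velocity x - P.velocity y)) = k₂) ∧
      (∀ᶠ ε : ℝ in 𝓝[>] 0, c + ε • (-P.velocity x + P.velocity y) ∈ P.supportᶜ ∧
        F (c + ε • (-P.velocity x + P.velocity y)) = k₃) ∧
      (∀ᶠ ε : ℝ in 𝓝[>] 0, c + ε • (-P.velocity x - P.velocity y) ∈ P.supportᶜ ∧
        F (c + ε • (-P.velocity x - P.velocity y)) = k₄) ∧
      (∀ᶠ q in 𝓝 c, q ∈ P.supportᶜ → F q ∈ ({k₁, k₂, k₃, k₄} : Set α)) ∧
      (∀ᶠ a : ℝ in 𝓝[>] 0, P.ConstNear F (P.curve x.1 (x.2 + a)) ↔ k₁ = k₂) ∧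
      (∀ᶠ a : ℝ in 𝓝[<] 0, P.ConstNear F (P.curve x.1 (x.2 + a)) ↔ k₃ = k₄) := by
  have hx0 : P.curve x.1 (x.2 + 0) = c := by rw [add_zero]; exact hx
  have hy0 : P.curve y.1 (y.2 + 0) = c := by rw [add_zero]; exact hy
  obtain ⟨e, he, h0, hsymm⟩ := exists_chart (P.hasStrictDerivAt_curve_add x.1 x.2)
    (P.hasStrictDerivAt_curve_add y.1 y.2) (p := c) hx0 hy0
    (P.transverse x y hxy (hx.trans hy.symm))
  change ∀ a b : ℝ, Tendsto (fun ε : ℝ => ε⁻¹ • e.symm (c + ε • (a • P.velocity x +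
    b • P.velocity y))) (𝓝[>] 0) (𝓝 (a, b)) at hsymm
  have he0 : e 0 = c := by
    rw [he, Prod.fst_zero, Prod.snd_zero, hx0, hy0, add_sub_cancel_right]
  obtain ⟨r, hr, hrs, hrS⟩ := exists_box_of_chart (S := P.support) (Q := True)
    (γ := fun a => P.curve x.1 (x.2 + a)) (δ := fun b => P.curve y.1 (y.2 + b)) he h0 hx0 hy0
    fun ρ hρ => by
      filter_upwards [P.eventually_exists_abs_sub_lt c hρ] with q hq hqS
      obtain ⟨j, s, hs⟩ := Set.mem_iUnion.1 hqS
      obtain ⟨s', hs', hlt⟩ := hq j s hs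
      refine ⟨s - s', hlt, ?_⟩
      rcases param_eq_or_of_curve_eq hxy hx hy hs' with h | h
      · exact Or.inl (by rw [← hs, curve_eq_of_param_eq h])
      · exact Or.inr ⟨trivial, by rw [← hs, curve_eq_of_param_eq h]⟩
  have hea : ∀ a, e (a, 0) = P.curve x.1 (x.2 + a) := fun a => by
    rw [he, hy0, add_sub_cancel_right]
  have heb : ∀ b, e (0, b) = P.curve y.1 (y.2 + b) := fun b => by
    rw [he, hx0, add_sub_cancel_left]
  set B := Set.Ioo (-r) r ×ˢ Set.Ioo (-r) r with hB
  have hBS : ∀ z ∈ B, e z ∈ P.support ↔ z.2 = 0 ∨ z.1 = 0 := fun z hz => by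
    refine ⟨fun h => by simpa using hrS z hz h, ?_⟩
    rintro (h | h)
    · have : z = (z.1, 0) := Prod.ext rfl h
      rw [this, hea]
      exact P.curve_mem_support _ _
    · have : z = (0, z.2) := Prod.ext h rfl
      rw [this, heb]
      exact P.curve_mem_support _ _
  have hquad : ∀ I J : Set ℝ, Convex ℝ I → Convex ℝ J → I ⊆ Set.Ioo (-r) r → J ⊆ Set.Ioo (-r) r →
      (0 : ℝ) ∉ I → (0 : ℝ) ∉ J → ∀ z ∈ I ×ˢ J, ∀ w ∈ I ×ˢ J, F (e z) = F (e w) := by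
    intro I J hI hJ hIr hJr hI0 hJ0 z hz w hw
    refine hF (e '' (I ×ˢ J)) ?_ ?_ _ ⟨z, hz, rfl⟩ _ ⟨w, hw, rfl⟩
    · rintro _ ⟨y, hy, rfl⟩ hyS
      rcases (hBS y ⟨hIr hy.1, hJr hy.2⟩).1 hyS with h | h
      · exact hJ0 (h ▸ hy.2)
      · exact hI0 (h ▸ hy.1)
    · exact (hI.prod hJ).isPreconnected.image _
        (e.continuousOn.mono ((Set.prod_mono hIr hJr).trans hrs))
  have pos_sub : Set.Ioo 0 r ⊆ Set.Ioo (-r) r := Set.Ioo_subset_Ioo_left (by linarith)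
  have neg_sub : Set.Ioo (-r) 0 ⊆ Set.Ioo (-r) r := Set.Ioo_subset_Ioo_right (by linarith)
  have hp : r / 2 ∈ Set.Ioo 0 r := ⟨by linarith, by linarith⟩
  have hm : -(r / 2) ∈ Set.Ioo (-r) 0 := ⟨by linarith, by linarith⟩
  -- In the chart, the ray in direction `a • u + b • v` is asymptotic to `ε • (a, b)`, so for small
  -- `ε` its coordinates have the signs of `a` and `b`. The conditions on `I` and `J` say that these
  -- sets are cut out of the box by such signs.
  have corner : ∀ (a b : ℝ) (I J : Set ℝ), Convex ℝ I → Convex ℝ J → I ⊆ Set.Ioo (-r) r →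
      J ⊆ Set.Ioo (-r) r → (0 : ℝ) ∉ I → (0 : ℝ) ∉ J →
      (∀ᶠ s in 𝓝 a, ∀ ε > 0, ε * s ∈ Set.Ioo (-r) r → ε * s ∈ I) →
      (∀ᶠ s in 𝓝 b, ∀ ε > 0, ε * s ∈ Set.Ioo (-r) r → ε * s ∈ J) → ∀ z ∈ I ×ˢ J,
      ∀ᶠ ε : ℝ in 𝓝[>] 0, c + ε • (a • P.velocity x + b • P.velocity y) ∈ P.supportᶜ ∧
        F (c + ε • (a • P.velocity x + b • P.velocity y)) = F (e z) := by
    intro a b I J hI hJ hIr hJr hI0 hJ0 ha hb z hz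
    have hab : ∀ᶠ w in 𝓝 (a, b), (∀ ε > 0, ε * w.1 ∈ Set.Ioo (-r) r → ε * w.1 ∈ I) ∧
        (∀ ε > 0, ε * w.2 ∈ Set.Ioo (-r) r → ε * w.2 ∈ J) :=
      (ha.prod_inl_nhds b).and (hb.prod_inr_nhds a)
    have hct : e 0 ∈ e.target := e.map_source h0
    rw [he0] at hct
    have hes : e.symm c = 0 := by rw [← he0, e.left_inv h0]
    have hlim : Tendsto (fun ε : ℝ => c + ε • (a • P.velocity x + b • P.velocity y)) (𝓝[>] 0)
        (𝓝 c) := by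
      have : Continuous fun ε : ℝ => c + ε • (a • P.velocity x + b • P.velocity y) := by fun_prop
      simpa using (this.tendsto 0).mono_left nhdsWithin_le_nhds
    have hB0 : B ∈ 𝓝 (e.symm c) := by
      rw [hes]
      exact (isOpen_Ioo.prod isOpen_Ioo).mem_nhds ⟨by simp [hr], by simp [hr]⟩
    have hmemB := hlim.eventually ((e.continuousAt_symm hct).eventually hB0)
    have hmemT := hlim.eventually (e.open_target.mem_nhds hct)
    filter_upwards [(hsymm a b).eventually hab, hmemB, hmemT, self_mem_nhdsWithin]
      with ε h1 h2 h3 (h4 : 0 < ε)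
    set w := e.symm (c + ε • (a • P.velocity x + b • P.velocity y)) with hw
    have hw1 : ε * (ε⁻¹ * w.1) = w.1 := by field_simp
    have hw2 : ε * (ε⁻¹ * w.2) = w.2 := by field_simp
    have hwIJ : w ∈ I ×ˢ J := by
      have h11 := h1.1 ε h4
      have h12 := h1.2 ε h4
      simp only [Prod.smul_fst, Prod.smul_snd, smul_eq_mul, hw1, hw2] at h11 h12
      exact ⟨h11 h2.1, h12 h2.2⟩
    have hew : e w = c + ε • (a • P.velocity x + b • P.velocity y) := e.right_inv h3
    rw [← hew]
    refine ⟨fun hS => ?_, hquad I J hI hJ hIr hJr hI0 hJ0 w hwIJ z hz⟩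
    rcases (hBS w h2).1 hS with h | h
    · exact hJ0 (h ▸ hwIJ.2)
    · exact hI0 (h ▸ hwIJ.1)
  have evp : ∀ᶠ s in 𝓝 (1 : ℝ), ∀ ε > 0, ε * s ∈ Set.Ioo (-r) r → ε * s ∈ Set.Ioo 0 r := by
    filter_upwards [lt_mem_nhds (zero_lt_one (α := ℝ))] with s hs ε hε hεs
    exact ⟨mul_pos hε hs, hεs.2⟩
  have evm : ∀ᶠ s in 𝓝 (-1 : ℝ), ∀ ε > 0, ε * s ∈ Set.Ioo (-r) r → ε * s ∈ Set.Ioo (-r) 0 := by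
    filter_upwards [gt_mem_nhds (neg_one_lt_zero (R := ℝ))] with s hs ε hε hεs
    exact ⟨hεs.1, mul_neg_of_pos_of_neg hε hs⟩
  have np : (0 : ℝ) ∉ Set.Ioo 0 r := by simp
  have nm : (0 : ℝ) ∉ Set.Ioo (-r) 0 := by simp
  refine ⟨F (e (r / 2, r / 2)), F (e (r / 2, -(r / 2))), F (e (-(r / 2), r / 2)),
    F (e (-(r / 2), -(r / 2))), ?_, ?_, ?_, ?_, ?_, ?_, ?_⟩
  · simpa only [one_smul] using corner 1 1 _ _ (convex_Ioo 0 r) (convex_Ioo 0 r) pos_sub pos_sub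
      np np evp evp (r / 2, r / 2) ⟨hp, hp⟩
  · simpa only [one_smul, neg_smul, ← sub_eq_add_neg] using corner 1 (-1) _ _ (convex_Ioo 0 r)
      (convex_Ioo (-r) 0) pos_sub neg_sub np nm evp evm (r / 2, -(r / 2)) ⟨hp, hm⟩
  · simpa only [one_smul, neg_smul] using corner (-1) 1 _ _ (convex_Ioo (-r) 0)
      (convex_Ioo 0 r) neg_sub pos_sub nm np evm evp (-(r / 2), r / 2) ⟨hm, hp⟩
  · simpa only [one_smul, neg_smul, ← sub_eq_add_neg] using corner (-1) (-1) _ _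
      (convex_Ioo (-r) 0) (convex_Ioo (-r) 0) neg_sub neg_sub nm nm evm evm
      (-(r / 2), -(r / 2)) ⟨hm, hm⟩
  · have hopen : IsOpen (e '' B) :=
      e.isOpen_image_of_subset_source (isOpen_Ioo.prod isOpen_Ioo) hrs
    have hmem : c ∈ e '' B := ⟨0, ⟨by simp [hr], by simp [hr]⟩, he0⟩
    filter_upwards [hopen.mem_nhds hmem]
    rintro _ ⟨z, hz, rfl⟩ hzS
    have hzne : ¬(z.2 = 0 ∨ z.1 = 0) := fun h => hzS ((hBS z hz).2 h)
    rw [not_or] at hzne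
    rcases lt_or_gt_of_ne hzne.1 with h2 | h2 <;> rcases lt_or_gt_of_ne hzne.2 with h1 | h1
    · right; right; right
      exact hquad _ _ (convex_Ioo (-r) 0) (convex_Ioo (-r) 0) neg_sub neg_sub nm nm _
        ⟨⟨hz.1.1, h1⟩, ⟨hz.2.1, h2⟩⟩ _ ⟨hm, hm⟩
    · right; left
      exact hquad _ _ (convex_Ioo 0 r) (convex_Ioo (-r) 0) pos_sub neg_sub np nm _
        ⟨⟨h1, hz.1.2⟩, ⟨hz.2.1, h2⟩⟩ _ ⟨hp, hm⟩
    · right; right; left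
      exact hquad _ _ (convex_Ioo (-r) 0) (convex_Ioo 0 r) neg_sub pos_sub nm np _
        ⟨⟨hz.1.1, h1⟩, ⟨h2, hz.2.2⟩⟩ _ ⟨hm, hp⟩
    · left
      exact hquad _ _ (convex_Ioo 0 r) (convex_Ioo 0 r) pos_sub pos_sub np np _
        ⟨⟨h1, hz.1.2⟩, ⟨h2, hz.2.2⟩⟩ _ ⟨hp, hp⟩
  -- Over the open half axis the second strand is absent, and the one-axis criterion applies with
  -- the two adjacent quadrants as sides.
  · filter_upwards [Ioo_mem_nhdsGT hr] with a ha
    rw [← hea]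
    refine constNear_iff_of_chart hF isOpen_Ioo (convex_Ioo 0 r)
      ((Set.prod_mono_left pos_sub).trans hrs) (fun z hz => ?_) ha hp hp hp hm
    rw [hBS z ⟨pos_sub hz.1, hz.2⟩, or_iff_left hz.1.1.ne']
  · filter_upwards [Ioo_mem_nhdsLT (neg_lt_zero.2 hr)] with a ha
    rw [← hea]
    refine constNear_iff_of_chart hF isOpen_Ioo (convex_Ioo (-r) 0)
      ((Set.prod_mono_left neg_sub).trans hrs) (fun z hz => ?_) ha hm hm hp hm
    rw [hBS z ⟨neg_sub hz.1, hz.2⟩, or_iff_left hz.1.2.ne]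

end LinkProjection

/-! ### Logarithmic integrals and winding numbers -/

/-- The integral of `dw / (w - z)` along a curve. -/
noncomputable def logIntegral (γ : ℝ → ℂ) (a b : ℝ) (z : ℂ) : ℂ :=
  ∫ t in a..b, deriv γ t / (γ t - z)

section LogIntegral

variable {γ : ℝ → ℂ} {a b : ℝ} {z : ℂ}

theorem continuousOn_deriv_div (hγ : ContDiff ℝ 1 γ) (hz : z ∉ γ '' Set.uIcc a b) :
    ContinuousOn (fun t => deriv γ t / (γ t - z)) (Set.uIcc a b) := by
  have h1 : Continuous (deriv γ) := hγ.continuous_deriv le_rfl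
  have h2 : Continuous γ := hγ.continuous
  refine h1.continuousOn.div (by fun_prop) fun t ht h0 => hz ⟨t, ht, sub_eq_zero.1 h0⟩

theorem intervalIntegrable_deriv_div (hγ : ContDiff ℝ 1 γ) (hz : z ∉ γ '' Set.uIcc a b) :
    IntervalIntegrable (fun t => deriv γ t / (γ t - z)) MeasureTheory.volume a b :=
  (continuousOn_deriv_div hγ hz).intervalIntegrable

/-- Dominated convergence: for points near `z` the denominator stays bounded below by half the
distance `m` that separates `z` from the compact curve. -/
theorem continuousAt_logIntegral (hγ : ContDiff ℝ 1 γ) (hz : z ∉ γ '' Set.uIcc a b) :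
    ContinuousAt (logIntegral γ a b) z := by
  have h1 : Continuous (deriv γ) := hγ.continuous_deriv le_rfl
  have h2 : Continuous γ := hγ.continuous
  have hopen : IsOpen (γ '' Set.uIcc a b)ᶜ := (isCompact_uIcc.image h2).isClosed.isOpen_compl
  obtain ⟨m, hm, hmz⟩ := Metric.isOpen_iff.1 hopen z hz
  have hfar : ∀ t ∈ Set.uIcc a b, m ≤ ‖γ t - z‖ := fun t ht => by
    by_contra! hlt
    exact hmz (mem_ball_iff_norm.2 hlt) ⟨t, ht, rfl⟩
  have hfar' : ∀ w ∈ Metric.ball z (m / 2), ∀ t ∈ Set.uIcc a b, m / 2 ≤ ‖γ t - w‖ := by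
    intro w hw t ht
    have h3 : γ t - z = (γ t - w) + (w - z) := by ring
    have h4 := norm_add_le (γ t - w) (w - z)
    rw [← h3] at h4
    have h5 := mem_ball_iff_norm.1 hw
    linarith [hfar t ht]
  refine intervalIntegral.continuousAt_of_dominated_interval
    (bound := fun t => ‖deriv γ t‖ * (m / 2)⁻¹) ?_ ?_ ?_ ?_
  · filter_upwards [Metric.ball_mem_nhds z (half_pos hm)] with w hw
    have hw' : w ∉ γ '' Set.uIcc a b := ?_
    · exact (intervalIntegrable_iff.1 (intervalIntegrable_deriv_div hγ hw')).aestronglyMeasurable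
    rintro ⟨t, ht, rfl⟩
    have := hfar' _ hw t ht
    simp only [sub_self, norm_zero] at this
    linarith
  · filter_upwards [Metric.ball_mem_nhds z (half_pos hm)] with w hw
    refine Filter.Eventually.of_forall fun t ht => ?_
    rw [norm_div, div_eq_mul_inv]
    have := hfar' w hw t (Set.uIoc_subset_uIcc ht)
    gcongr
  · exact (h1.norm.mul continuous_const).intervalIntegrable _ _
  · refine Filter.Eventually.of_forall fun t ht => ?_
    refine continuousAt_const.div (by fun_prop) fun h0 => ?_
    exact hz ⟨t, Set.uIoc_subset_uIcc ht, sub_eq_zero.1 h0⟩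

/-- The product of `γ s - z` with the exponential of minus the integral up to `s` has derivative
zero. -/
theorem exp_logIntegral (hγ : ContDiff ℝ 1 γ) (hab : a ≤ b) (hz : z ∉ γ '' Set.uIcc a b) :
    Complex.exp (logIntegral γ a b z) * (γ a - z) = γ b - z := by
  rw [Set.uIcc_of_le hab] at hz
  have hcont : ContinuousOn (fun t => deriv γ t / (γ t - z)) (Set.Icc a b) := by
    have := continuousOn_deriv_div (a := a) (b := b) (z := z) hγ (by rwa [Set.uIcc_of_le hab])
    rwa [Set.uIcc_of_le hab] at this
  have hne : ∀ t ∈ Set.Icc a b, γ t - z ≠ 0 := fun t ht h0 => hz ⟨t, ht, sub_eq_zero.1 h0⟩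
  have hI : ∀ t ∈ Set.Icc a b, HasDerivWithinAt (fun s => logIntegral γ a s z)
      (deriv γ t / (γ t - z)) (Set.Icc a b) t := by
    intro t ht
    have hint : IntervalIntegrable (fun t => deriv γ t / (γ t - z)) MeasureTheory.volume a t :=
      (hcont.mono (by rw [Set.uIcc_of_le ht.1]; exact Set.Icc_subset_Icc_right ht.2)).intervalIntegrable
    have : Fact (t ∈ Set.Icc a b) := ⟨ht⟩
    exact intervalIntegral.integral_hasDerivWithinAt_right hint
      (hcont.stronglyMeasurableAtFilter_nhdsWithin measurableSet_Icc t) (hcont t ht)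
  have hd : ∀ t ∈ Set.Icc a b,
      HasDerivWithinAt (fun s => Complex.exp (-logIntegral γ a s z) * (γ s - z)) 0
        (Set.Icc a b) t := by
    intro t ht
    have h1 := (hI t ht).neg.cexp
    have h2 : HasDerivWithinAt (fun s => γ s - z) (deriv γ t) (Set.Icc a b) t :=
      (((hγ.differentiable one_ne_zero) t).hasDerivAt.sub_const z).hasDerivWithinAt
    refine (h1.mul h2).congr_deriv ?_
    have := hne t ht
    field_simp
    ring
  have hconst := constant_of_has_deriv_right_zero (a := a) (b := b)
    (f := fun s => Complex.exp (-logIntegral γ a s z) * (γ s - z))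
    (fun t ht => (hd t ht).continuousWithinAt)
    (fun t ht => ((hd t ⟨ht.1, ht.2.le⟩).mono_of_mem_nhdsWithin
      (Icc_mem_nhdsGE_of_mem ht))) b ⟨hab, le_rfl⟩
  have h0 : logIntegral γ a a z = 0 := intervalIntegral.integral_same
  simp only [h0, neg_zero, Complex.exp_zero, one_mul] at hconst
  rw [← hconst, ← mul_assoc, ← Complex.exp_add]
  simp

theorem exists_logIntegral_eq (hγ : ContDiff ℝ 1 γ) (hab : a ≤ b) (hclosed : γ a = γ b)
    (hz : z ∉ γ '' Set.uIcc a b) : ∃ k : ℤ, logIntegral γ a b z = k * (2 * Real.pi * Complex.I) := by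
  rw [← Complex.exp_eq_one_iff]
  have h := exp_logIntegral hγ hab hz
  rw [← hclosed] at h
  refine mul_right_cancel₀ (b := γ a - z) (fun h0 => hz ⟨a, Set.left_mem_uIcc, sub_eq_zero.1 h0⟩) ?_
  rw [h, one_mul]

theorem log_sub_log_neg_of_im_pos {w : ℂ} (h : 0 < w.im) :
    Complex.log w - Complex.log (-w) = Real.pi * Complex.I := by
  rw [Complex.log, Complex.log, norm_neg, Complex.arg_neg_eq_arg_sub_pi_of_im_pos h]
  push_cast
  ring

theorem log_sub_log_neg_of_im_neg {w : ℂ} (h : w.im < 0) :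
    Complex.log w - Complex.log (-w) = -(Real.pi * Complex.I) := by
  rw [Complex.log, Complex.log, norm_neg, Complex.arg_neg_eq_arg_add_pi_of_im_neg h]
  push_cast
  ring

/-- A logarithm on a slit plane computes the integral. -/
theorem logIntegral_eq_log_sub_log (hγ : ContDiff ℝ 1 γ) {κ : ℂ}
    (h : ∀ t ∈ Set.uIcc a b, κ * (γ t - z) ∈ Complex.slitPlane) :
    logIntegral γ a b z = Complex.log (κ * (γ b - z)) - Complex.log (κ * (γ a - z)) := by
  refine intervalIntegral.integral_eq_sub_of_hasDerivAt
    (f := fun t => Complex.log (κ * (γ t - z))) (fun t ht => ?_) ?_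
  · have h1 : HasDerivAt (fun t => κ * (γ t - z)) (κ * deriv γ t) t :=
      (((hγ.differentiable one_ne_zero) t).hasDerivAt.sub_const z).const_mul κ
    refine (h1.clog_real (h t ht)).congr_deriv ?_
    have := Complex.slitPlane_ne_zero (h t ht)
    have hκ : κ ≠ 0 := left_ne_zero_of_mul this
    have hz : γ t - z ≠ 0 := right_ne_zero_of_mul this
    field_simp
  · refine intervalIntegrable_deriv_div hγ ?_
    rintro ⟨t, ht, rfl⟩
    have := Complex.slitPlane_ne_zero (h t ht)
    simp at this

/-- The jump of the integral when crossing the curve, for a curve which moves to the right. -/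
theorem tendsto_logIntegral_sub_aux {g : ℝ → ℂ} {t₀ : ℝ} (hg : ContDiff ℝ 1 g)
    (ht : t₀ ∈ Set.Ioo a b) (h0 : g t₀ = 0) (h1 : deriv g t₀ = 1)
    (hinj : ∀ t ∈ Set.Icc a b, g t = 0 → t = t₀) :
    Tendsto (fun ε : ℝ => logIntegral g a b (ε * Complex.I) - logIntegral g a b (-(ε * Complex.I)))
      (𝓝[>] 0) (𝓝 (2 * Real.pi * Complex.I)) := by
  have hgc : Continuous g := hg.continuous
  have hgd : HasDerivAt g 1 t₀ := h1 ▸ ((hg.differentiable one_ne_zero) t₀).hasDerivAt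
  have hsign : ∀ᶠ t in 𝓝 t₀, |(g t).re - (t - t₀)| ≤ 1 / 2 * |t - t₀| := by
    have := (hasDerivAt_iff_isLittleO.1 hgd).def (by norm_num : (0 : ℝ) < 1 / 2)
    filter_upwards [this] with t ht
    rw [h0, sub_zero, Real.norm_eq_abs] at ht
    refine le_trans ?_ ht
    simpa using Complex.abs_re_le_norm (g t - (t - t₀) • (1 : ℂ))
  obtain ⟨δ, hδ, hδ'⟩ := Metric.eventually_nhds_iff_ball.1
    (hsign.and (isOpen_Ioo.mem_nhds ht))
  set l := t₀ - δ / 2 with hl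
  set r := t₀ + δ / 2 with hr
  have hball : ∀ t ∈ Set.Icc l r, t ∈ Metric.ball t₀ δ := fun t ht' => by
    rw [Real.ball_eq_Ioo]
    exact ⟨by linarith [ht'.1], by linarith [ht'.2]⟩
  have hlr : l ≤ r := by linarith
  have hal : a < l := (hδ' l (hball l ⟨le_rfl, hlr⟩)).2.1
  have hrb : r < b := (hδ' r (hball r ⟨hlr, le_rfl⟩)).2.2
  have hpos : ∀ t ∈ Set.Icc l r, t₀ < t → 0 < (g t).re := fun t ht' hlt => by
    have := (hδ' t (hball t ht')).1
    rw [abs_of_pos (sub_pos.2 hlt)] at this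
    linarith [(abs_le.1 this).1]
  have hneg : ∀ t ∈ Set.Icc l r, t < t₀ → (g t).re < 0 := fun t ht' hlt => by
    have := (hδ' t (hball t ht')).1
    rw [abs_of_neg (sub_neg.2 hlt)] at this
    linarith [(abs_le.1 this).2]
  have hre : ∀ t ∈ Set.Icc l r, t ≠ t₀ → (g t).re ≠ 0 := fun t ht' hne => by
    rcases lt_or_gt_of_ne hne with h | h
    · exact (hneg t ht' h).ne
    · exact (hpos t ht' h).ne'
  have hgl := hneg l ⟨le_rfl, hlr⟩ (by linarith)
  have hgr := hpos r ⟨hlr, le_rfl⟩ (by linarith)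
  -- After the rotation by `Complex.I`, the imaginary part is `(g t).re`, which vanishes only at
  -- `t₀`, where the value is the positive real `ε`. For the point below the curve, the rotation by
  -- `-Complex.I` plays the same role.
  have slit1 : ∀ ε : ℝ, 0 < ε → ∀ t ∈ Set.Icc l r,
      Complex.I * (g t - ε * Complex.I) ∈ Complex.slitPlane := by
    intro ε hε t ht'
    rw [Complex.mem_slitPlane_iff]
    by_cases h : t = t₀
    · left; simp [h, h0, hε]
    · right; simpa using hre t ht' h
  have slit2 : ∀ ε : ℝ, 0 < ε → ∀ t ∈ Set.Icc l r,
      -Complex.I * (g t - -(ε * Complex.I)) ∈ Complex.slitPlane := by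
    intro ε hε t ht'
    rw [Complex.mem_slitPlane_iff]
    by_cases h : t = t₀
    · left; simp [h, h0, hε]
    · right; simpa using hre t ht' h
  have hout1 : (0 : ℂ) ∉ g '' Set.uIcc a l := by
    rintro ⟨t, ht', h⟩
    rw [Set.uIcc_of_le hal.le] at ht'
    have := hinj t ⟨ht'.1, by linarith [ht'.2]⟩ h
    linarith [ht'.2]
  have hout2 : (0 : ℂ) ∉ g '' Set.uIcc r b := by
    rintro ⟨t, ht', h⟩
    rw [Set.uIcc_of_le hrb.le] at ht'
    have := hinj t ⟨by linarith [ht'.1], ht'.2⟩ h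
    linarith [ht'.1]
  have lim1 : Tendsto (fun ε : ℝ => (ε : ℂ) * Complex.I) (𝓝[>] 0) (𝓝 0) := by
    have : Continuous fun ε : ℝ => (ε : ℂ) * Complex.I := by fun_prop
    simpa using (this.tendsto 0).mono_left nhdsWithin_le_nhds
  have lim2 : Tendsto (fun ε : ℝ => -((ε : ℂ) * Complex.I)) (𝓝[>] 0) (𝓝 0) := by
    simpa using lim1.neg
  have hend : ∀ t, (g t).re ≠ 0 → ∀ κ : ℂ, κ = Complex.I ∨ κ = -Complex.I → ∀ f : ℝ → ℂ,
      Tendsto f (𝓝[>] 0) (𝓝 0) →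
      Tendsto (fun ε : ℝ => Complex.log (κ * (g t - f ε))) (𝓝[>] 0) (𝓝 (Complex.log (κ * g t))) := by
    intro t ht' κ hκ f hf
    refine Tendsto.clog ?_ ?_
    · simpa using (tendsto_const_nhds (x := g t)).sub hf |>.const_mul κ
    · rw [Complex.mem_slitPlane_iff]
      right
      rcases hκ with rfl | rfl <;> simpa using ht'
  have arc : Tendsto (fun ε : ℝ => logIntegral g l r (ε * Complex.I) -
      logIntegral g l r (-(ε * Complex.I))) (𝓝[>] 0) (𝓝 (2 * Real.pi * Complex.I)) := by
    have hlim := ((hend r hgr.ne' _ (Or.inl rfl) _ lim1).sub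
      (hend l hgl.ne _ (Or.inl rfl) _ lim1)).sub
      ((hend r hgr.ne' _ (Or.inr rfl) _ lim2).sub (hend l hgl.ne _ (Or.inr rfl) _ lim2))
    -- Opposite arguments have logarithms differing by `π i` or `-π i` according to the half plane.
    -- The right end contributes `π i` and the left end, subtracted, another `π i`.
    have hval : Complex.log (Complex.I * g r) - Complex.log (Complex.I * g l) -
        (Complex.log (-Complex.I * g r) - Complex.log (-Complex.I * g l)) =
        2 * Real.pi * Complex.I := by
      have e1 := log_sub_log_neg_of_im_pos (w := Complex.I * g r) (by simpa using hgr)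
      have e2 := log_sub_log_neg_of_im_neg (w := Complex.I * g l) (by simpa using hgl)
      rw [neg_mul, neg_mul]
      linear_combination e1 - e2
    rw [hval] at hlim
    refine hlim.congr' ?_
    filter_upwards [self_mem_nhdsWithin] with ε (hε : 0 < ε)
    rw [logIntegral_eq_log_sub_log hg (by rw [Set.uIcc_of_le hlr]; exact slit1 ε hε),
      logIntegral_eq_log_sub_log hg (by rw [Set.uIcc_of_le hlr]; exact slit2 ε hε)]
  -- The rest of the curve misses the origin, so its contribution is continuous there and cancels in
  -- the limit.
  have rest1 : Tendsto (fun ε : ℝ => logIntegral g a l (ε * Complex.I) -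
      logIntegral g a l (-(ε * Complex.I))) (𝓝[>] 0) (𝓝 0) := by
    have := continuousAt_logIntegral hg hout1
    simpa using (this.tendsto.comp lim1).sub (this.tendsto.comp lim2)
  have rest2 : Tendsto (fun ε : ℝ => logIntegral g r b (ε * Complex.I) -
      logIntegral g r b (-(ε * Complex.I))) (𝓝[>] 0) (𝓝 0) := by
    have := continuousAt_logIntegral hg hout2
    simpa using (this.tendsto.comp lim1).sub (this.tendsto.comp lim2)
  have hopen1 : IsOpen (g '' Set.uIcc a l)ᶜ := (isCompact_uIcc.image hgc).isClosed.isOpen_compl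
  have hopen2 : IsOpen (g '' Set.uIcc r b)ᶜ := (isCompact_uIcc.image hgc).isClosed.isOpen_compl
  have total := (rest1.add arc).add rest2
  rw [zero_add, add_zero] at total
  refine total.congr' ?_
  filter_upwards [self_mem_nhdsWithin, lim1.eventually (hopen1.mem_nhds hout1),
    lim1.eventually (hopen2.mem_nhds hout2), lim2.eventually (hopen1.mem_nhds hout1),
    lim2.eventually (hopen2.mem_nhds hout2)] with ε (hε : 0 < ε) h11 h12 h21 h22
  have split : ∀ z : ℂ, z ∉ g '' Set.uIcc a l → z ∉ g '' Set.uIcc l r → z ∉ g '' Set.uIcc r b →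
      logIntegral g a b z = logIntegral g a l z + logIntegral g l r z + logIntegral g r b z := by
    intro z hz1 hz2 hz3
    have i1 := intervalIntegrable_deriv_div hg hz1
    have i2 := intervalIntegrable_deriv_div hg hz2
    have i3 := intervalIntegrable_deriv_div hg hz3
    rw [logIntegral, logIntegral, logIntegral, logIntegral,
      intervalIntegral.integral_add_adjacent_intervals i1 i2,
      intervalIntegral.integral_add_adjacent_intervals (i1.trans i2) i3]
  have off : ∀ (κ z : ℂ), (∀ t ∈ Set.Icc l r, κ * (g t - z) ∈ Complex.slitPlane) →
      z ∉ g '' Set.uIcc l r := by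
    rintro κ _ h ⟨t, ht', rfl⟩
    rw [Set.uIcc_of_le hlr] at ht'
    have := Complex.slitPlane_ne_zero (h t ht')
    simp at this
  rw [split _ h11 (off _ _ (slit1 ε hε)) h12, split _ h21 (off _ _ (slit2 ε hε)) h22]
  ring

/-- The jump of the integral when crossing the curve. -/
theorem tendsto_logIntegral_sub {t₀ : ℝ} (hγ : ContDiff ℝ 1 γ) (ht : t₀ ∈ Set.Ioo a b)
    (h1 : deriv γ t₀ ≠ 0) (hinj : ∀ t ∈ Set.Icc a b, γ t = γ t₀ → t = t₀) :
    Tendsto (fun ε : ℝ => logIntegral γ a b (γ t₀ + ε • (Complex.I * deriv γ t₀)) -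
      logIntegral γ a b (γ t₀ - ε • (Complex.I * deriv γ t₀)))
      (𝓝[>] 0) (𝓝 (2 * Real.pi * Complex.I)) := by
  set u := deriv γ t₀ with hu
  let g : ℝ → ℂ := fun t => (γ t - γ t₀) / u
  have hgd : ∀ t, deriv g t = deriv γ t / u := fun t => by
    rw [show g = fun t => (γ t - γ t₀) / u from rfl, deriv_div_const, deriv_sub_const]
  have hg : ContDiff ℝ 1 g := (hγ.sub contDiff_const).div_const u
  have key : ∀ ζ : ℂ, logIntegral g a b ζ = logIntegral γ a b (γ t₀ + ζ * u) := by
    intro ζ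
    rw [logIntegral, logIntegral]
    congr 1
    ext t
    rw [hgd]
    have : g t - ζ = (γ t - (γ t₀ + ζ * u)) / u := by
      simp only [g]
      field_simp
      ring
    rw [this, div_div_div_cancel_right₀ h1]
  have := tendsto_logIntegral_sub_aux hg ht (by simp [g]) (by rw [hgd, div_self h1])
    fun t ht' h => hinj t ht' (by simpa [g, h1, sub_eq_zero] using h)
  refine this.congr fun ε => ?_
  rw [key, key, Complex.real_smul]
  congr 2 <;> ring

/-- The winding number of a closed curve around a point. -/
noncomputable def windingNumber (γ : ℝ → ℂ) (a b : ℝ) (z : ℂ) : ℤ :=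
  round (logIntegral γ a b z / (2 * Real.pi * Complex.I)).re

/-- The rounding is exact off the curve. Only the end points have to match, not the end velocities,
so a loop cut out at a crossing is allowed. -/
theorem logIntegral_eq_windingNumber (hγ : ContDiff ℝ 1 γ) (hab : a ≤ b) (hclosed : γ a = γ b)
    (hz : z ∉ γ '' Set.uIcc a b) :
    logIntegral γ a b z = windingNumber γ a b z * (2 * Real.pi * Complex.I) := by
  obtain ⟨k, hk⟩ := exists_logIntegral_eq hγ hab hclosed hz
  rw [windingNumber, hk, mul_div_cancel_right₀ _ Complex.two_pi_I_ne_zero, Complex.intCast_re,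
    round_intCast]

/-- The values of the integral at two sequences of points determine the difference of the winding
numbers. -/
theorem eventually_windingNumber_sub {ι : Type*} {l : Filter ι} {f g : ι → ℂ} {k : ℤ}
    (hγ : ContDiff ℝ 1 γ) (hab : a ≤ b) (hclosed : γ a = γ b)
    (hf : ∀ᶠ i in l, f i ∉ γ '' Set.uIcc a b) (hg : ∀ᶠ i in l, g i ∉ γ '' Set.uIcc a b)
    (h : Tendsto (fun i => logIntegral γ a b (f i) - logIntegral γ a b (g i)) l
      (𝓝 (k * (2 * Real.pi * Complex.I)))) :
    ∀ᶠ i in l, windingNumber γ a b (f i) - windingNumber γ a b (g i) = k := by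
  have h' := h.div_const (2 * Real.pi * Complex.I)
  rw [mul_div_cancel_right₀ _ Complex.two_pi_I_ne_zero] at h'
  filter_upwards [hf, hg, h'.eventually (Metric.ball_mem_nhds _ one_pos)] with i h1 h2 h3
  rw [logIntegral_eq_windingNumber hγ hab hclosed h1, logIntegral_eq_windingNumber hγ hab hclosed h2,
    ← sub_mul, mul_div_cancel_right₀ _ Complex.two_pi_I_ne_zero, dist_eq_norm] at h3
  -- An integer of absolute value less than one is zero.
  have h4 : ‖((windingNumber γ a b (f i) - windingNumber γ a b (g i) - k : ℤ) : ℂ)‖ < 1 := by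
    push_cast
    exact h3
  rw [Complex.norm_intCast, ← Int.cast_abs] at h4
  have h5 : |windingNumber γ a b (f i) - windingNumber γ a b (g i) - k| < 1 := by exact_mod_cast h4
  exact sub_eq_zero.1 (Int.abs_lt_one_iff.1 h5)

theorem eventually_windingNumber_eq (hγ : ContDiff ℝ 1 γ) (hab : a ≤ b) (hclosed : γ a = γ b)
    (hz : z ∉ γ '' Set.uIcc a b) :
    ∀ᶠ w in 𝓝 z, windingNumber γ a b w = windingNumber γ a b z := by
  have hopen : IsOpen (γ '' Set.uIcc a b)ᶜ :=
    (isCompact_uIcc.image hγ.continuous).isClosed.isOpen_compl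
  have h := eventually_windingNumber_sub (l := 𝓝 z) (f := id) (g := fun _ => z) (k := 0) hγ hab
    hclosed (hopen.mem_nhds hz) (Eventually.of_forall fun _ => hz) (by
      simpa using (continuousAt_logIntegral hγ hz).tendsto.sub_const (logIntegral γ a b z))
  filter_upwards [h] with w hw
  exact sub_eq_zero.1 hw

theorem windingNumber_eq_of_isPreconnected (hγ : ContDiff ℝ 1 γ) (hab : a ≤ b)
    (hclosed : γ a = γ b) {A : Set ℂ} (hA : IsPreconnected A) (hAγ : A ⊆ (γ '' Set.uIcc a b)ᶜ)
    {w : ℂ} (hz : z ∈ A) (hw : w ∈ A) : windingNumber γ a b z = windingNumber γ a b w := by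
  refine hA.constant (f := windingNumber γ a b) (fun x hx => ?_) hz hw
  refine ContinuousAt.continuousWithinAt ?_
  exact (continuousAt_const (y := windingNumber γ a b x)).congr
    ((eventually_windingNumber_eq hγ hab hclosed (hAγ hx)).mono fun _ h => h.symm)

theorem windingNumber_eq_of_periodic (h : Function.Periodic γ 1) (a z) :
    windingNumber γ a (a + 1) z = windingNumber γ 0 1 z := by
  have hd : Function.Periodic (deriv γ) 1 := fun t => by
    rw [← deriv_comp_add_const]
    congr 1
    exact funext h
  have hper : Function.Periodic (fun t => deriv γ t / (γ t - z)) 1 := fun t => by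
    simp only [h t, hd t]
  have := hper.intervalIntegral_add_eq a 0
  rw [zero_add] at this
  rw [windingNumber, windingNumber, logIntegral, logIntegral, this]

end LogIntegral

/-! ### Sides of the curves, finiteness of the set of regions, functions without jumps -/

namespace LinkProjection

variable {n : ℕ} {P : LinkProjection n}

/-- The two sides of the curves at a regular point. -/
theorem exists_sides {i : Fin n} {t : ℝ} (h : P.curve i t ∉ P.doublePoints) :
    ∃ l ∈ P.supportᶜ, ∃ r ∈ P.supportᶜ,
      (∀ᶠ ε : ℝ in 𝓝[>] 0,
        P.curve i t + ε • (Complex.I * deriv (P.curve i) t) ∈ P.supportᶜ ∧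
        P.curve i t - ε • (Complex.I * deriv (P.curve i) t) ∈ P.supportᶜ) ∧
      ∀ {α : Type} {F : ℂ → α}, P.ConstOnRegions F →
        (∀ᶠ s in 𝓝 t, P.ConstNear F (P.curve i s) ↔ F l = F r) ∧
        ∀ᶠ q in 𝓝 (P.curve i t), q ∈ P.supportᶜ → F q = F l ∨ F q = F r := by
  obtain ⟨e, r, hr, hrs, hrS, he⟩ := exists_chart_regular h
  have hp : r / 2 ∈ Set.Ioo 0 r := ⟨by linarith, by linarith⟩
  have hm : -(r / 2) ∈ Set.Ioo (-r) 0 := ⟨by linarith, by linarith⟩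
  have h0 : (0 : ℝ) ∈ Set.Ioo (-r) r := by simp [hr]
  have pos_sub : Set.Ioo 0 r ⊆ Set.Ioo (-r) r := Set.Ioo_subset_Ioo_left (by linarith)
  have neg_sub : Set.Ioo (-r) 0 ⊆ Set.Ioo (-r) r := Set.Ioo_subset_Ioo_right (by linarith)
  -- The sample points on the two sides are chosen before `F`; this later makes the jump a linear
  -- function of the colouring.
  refine ⟨e (0, r / 2), fun hS => hp.1.ne' ((hrS _ ⟨h0, pos_sub hp⟩).1 hS), e (0, -(r / 2)),
    fun hS => hm.2.ne ((hrS _ ⟨h0, neg_sub hm⟩).1 hS), ?_, fun {α F} hF => ⟨?_, ?_⟩⟩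
  · filter_upwards [Ioo_mem_nhdsGT hr] with ε hε
    have hε' : -ε ∈ Set.Ioo (-r) 0 := ⟨by linarith [hε.2], by linarith [hε.1]⟩
    have e1 := he 0 ε
    have e2 := he 0 (-ε)
    rw [add_zero] at e1 e2
    rw [neg_smul, ← sub_eq_add_neg] at e2
    rw [← e1, ← e2]
    exact ⟨fun hS => hε.1.ne' ((hrS _ ⟨h0, pos_sub hε⟩).1 hS),
      fun hS => hε'.2.ne ((hrS _ ⟨h0, neg_sub hε'⟩).1 hS)⟩
  · have hev : ∀ᶠ s in 𝓝 t, s - t ∈ Set.Ioo (-r) r :=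
      (continuous_sub_right t).continuousAt.preimage_mem_nhds
        (by simpa only [sub_self] using isOpen_Ioo.mem_nhds h0)
    filter_upwards [hev] with s hs
    have hes : e (s - t, 0) = P.curve i s := by rw [he]; simp
    rw [← hes]
    exact constNear_iff_of_chart hF isOpen_Ioo (convex_Ioo _ _) hrs hrS hs h0 h0 hp hm
  · have hopen : IsOpen (e '' (Set.Ioo (-r) r ×ˢ Set.Ioo (-r) r)) :=
      e.isOpen_image_of_subset_source (isOpen_Ioo.prod isOpen_Ioo) hrs
    have he0 : e (0, 0) = P.curve i t := by rw [he]; simp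
    filter_upwards [hopen.mem_nhds ⟨(0, 0), ⟨h0, h0⟩, he0⟩]
    have hside : ∀ J : Set ℝ, Convex ℝ J → J ⊆ Set.Ioo (-r) r → (0 : ℝ) ∉ J →
        ∀ z ∈ Set.Ioo (-r) r ×ˢ J, ∀ w ∈ Set.Ioo (-r) r ×ˢ J, F (e z) = F (e w) := by
      intro J hJ hJr hJ0 z hz w hw
      refine hF (e '' (Set.Ioo (-r) r ×ˢ J)) ?_ ?_ _ ⟨z, hz, rfl⟩ _ ⟨w, hw, rfl⟩
      · rintro _ ⟨y, hy, rfl⟩ hyS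
        exact hJ0 ((hrS y ⟨hy.1, hJr hy.2⟩).1 hyS ▸ hy.2)
      · exact ((convex_Ioo _ _).prod hJ).isPreconnected.image _
          (e.continuousOn.mono ((Set.prod_mono_right hJr).trans hrs))
    rintro _ ⟨z, hz, rfl⟩ hzS
    have hz2 : z.2 ≠ 0 := fun h => hzS ((hrS z hz).2 h)
    rcases lt_or_gt_of_ne hz2 with h2 | h2
    · right
      exact hside _ (convex_Ioo (-r) 0) neg_sub (by simp) _ ⟨hz.1, hz.2.1, h2⟩ _ ⟨h0, hm⟩
    · left
      exact hside _ (convex_Ioo 0 r) pos_sub (by simp) _ ⟨hz.1, h2, hz.2.2⟩ _ ⟨h0, hp⟩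

-- This is the universal function constant on the regions: applied to it, the local lemmas become
-- statements about the regions themselves.
variable (P) in
theorem constOnRegions_connectedComponentIn :
    P.ConstOnRegions fun q => connectedComponentIn P.supportᶜ q := by
  intro A hA hAc x hx y hy
  exact connectedComponentIn_eq (hAc.subset_connectedComponentIn hx hA hy)

-- A corner direction at a crossing, or a normal direction at a regular point, leads off the curves.
variable (P) in
theorem nhdsWithin_compl_support_neBot (p : ℂ) : (𝓝[P.supportᶜ] p).NeBot := by
  by_cases hp : p ∈ P.support
  · obtain ⟨i, t, rfl⟩ := Set.mem_iUnion.1 hp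
    have key : ∀ d : ℂ, (∀ᶠ ε : ℝ in 𝓝[>] 0, P.curve i t + ε • d ∈ P.supportᶜ) →
        (𝓝[P.supportᶜ] (P.curve i t)).NeBot := by
      intro d hd
      have hlim : Tendsto (fun ε : ℝ => P.curve i t + ε • d) (𝓝[>] 0) (𝓝 (P.curve i t)) := by
        have : Continuous fun ε : ℝ => P.curve i t + ε • d := by fun_prop
        simpa using (this.tendsto 0).mono_left nhdsWithin_le_nhds
      exact (tendsto_nhdsWithin_iff.2 ⟨hlim, hd⟩).neBot
    by_cases h : P.curve i t ∈ P.doublePoints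
    · obtain ⟨x, y, hxy, hx, hy⟩ := h
      obtain ⟨_, _, _, _, h1, -⟩ :=
        exists_corner_values P.constOnRegions_connectedComponentIn hxy hx hy
      exact key _ (h1.mono fun _ h => h.1)
    · obtain ⟨_, _, _, _, h1, -⟩ := exists_sides h
      exact key _ (h1.mono fun _ h => h.1)
  · rw [P.isOpen_compl_support.nhdsWithin_eq hp]
    infer_instance

/-- A function which is constant on the regions takes finitely many values near a point. -/
theorem exists_finite_values {α : Type} {F : ℂ → α} (hF : P.ConstOnRegions F) {p : ℂ}
    (hp : p ∈ P.support) :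
    ∃ T : Set α, T.Finite ∧ ∀ᶠ q in 𝓝 p, q ∈ P.supportᶜ → F q ∈ T := by
  obtain ⟨i, t, rfl⟩ := Set.mem_iUnion.1 hp
  by_cases h : P.curve i t ∈ P.doublePoints
  · obtain ⟨x, y, hxy, hx, hy⟩ := h
    obtain ⟨k₁, k₂, k₃, k₄, -, -, -, -, h5, -⟩ := exists_corner_values hF hxy hx hy
    exact ⟨_, Set.toFinite _, h5⟩
  · obtain ⟨l, _, r, _, -, h2⟩ := exists_sides h
    exact ⟨{F l, F r}, Set.toFinite _, (h2 hF).2⟩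

/-- Finitely many neighbourhoods, each meeting finitely many regions, cover the compact union of the
curves. Every region meets one of them: the open ball around a point `q` of the region up to a
nearest point `p` of the curves stays in the region and has `p` in its closure. -/
instance finite_region : Finite P.Region := by
  have hfin : {R : Set ℂ | ∃ q ∈ P.supportᶜ, R = connectedComponentIn P.supportᶜ q}.Finite := by
    by_cases hne : P.support.Nonempty
    · choose! T hT hTq using fun p (hp : p ∈ P.support) =>
        exists_finite_values P.constOnRegions_connectedComponentIn hp
      obtain ⟨s, hs, hcover⟩ := P.isCompact_support.elim_nhds_subcover
        (fun p => interior {q | q ∈ P.supportᶜ → connectedComponentIn P.supportᶜ q ∈ T p})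
        fun p hp => interior_mem_nhds.2 (hTq p hp)
      refine (s.finite_toSet.biUnion fun p hp => hT p (hs p hp)).subset ?_
      rintro R ⟨q, hq, rfl⟩
      obtain ⟨p, hp, hdist⟩ := P.isCompact_support.exists_infDist_eq_dist hne q
      obtain ⟨p', hp', hpp'⟩ := Set.mem_iUnion₂.1 (hcover hp)
      refine Set.mem_biUnion (Finset.mem_coe.2 hp') ?_
      have hball : Metric.ball q (dist q p) ⊆ P.supportᶜ := fun w hw hwS => by
        have := Metric.infDist_le_dist_of_mem (x := q) hwS
        rw [hdist, dist_comm q w] at this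
        exact absurd (Metric.mem_ball.1 hw) (not_lt.2 this)
      have hpos : 0 < dist q p := dist_pos.2 fun h => hq (h ▸ hp)
      have hcl : p ∈ closure (Metric.ball q (dist q p)) := by
        rw [closure_ball q hpos.ne', Metric.mem_closedBall, dist_comm]
      obtain ⟨w, hw, hwb⟩ := mem_closure_iff.1 hcl _ isOpen_interior hpp'
      have h1 := interior_subset hw (hball hwb)
      have h2 : connectedComponentIn P.supportᶜ w = connectedComponentIn P.supportᶜ q :=
        P.constOnRegions_connectedComponentIn _ hball (convex_ball _ _).isPreconnected _ hwb _
          (Metric.mem_ball_self hpos)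
      exact h2 ▸ h1
    · rw [Set.not_nonempty_iff_eq_empty] at hne
      refine (Set.finite_singleton Set.univ).subset ?_
      rintro R ⟨q, -, rfl⟩
      rw [hne, Set.compl_empty, Set.mem_singleton_iff]
      exact isPreconnected_univ.connectedComponentIn (Set.mem_univ q)
  exact hfin.to_subtype

/-- A function which is constant on the regions and does not change across the curves at regular
points is constant. -/
theorem eq_of_constNear {α : Type} {F : ℂ → α} (hF : P.ConstOnRegions F)
    (h : ∀ i t, P.curve i t ∉ P.doublePoints → P.ConstNear F (P.curve i t)) {p q : ℂ}
    (hp : p ∈ P.supportᶜ) (hq : q ∈ P.supportᶜ) : F p = F q := by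
  refine eq_of_eventually_const P.nhdsWithin_compl_support_neBot (fun z => ?_) hp hq
  change P.ConstNear F z
  by_cases hz : z ∈ P.support
  · by_cases hzd : z ∈ P.doublePoints
    · obtain ⟨x, y, hxy, hx, hy⟩ := hzd
      have reg : ∀ x : LinkParam n, ∀ᶠ a : ℝ in 𝓝[≠] 0,
          P.ConstNear F (P.curve x.1 (x.2 + a)) := by
        intro x
        have hlim : Tendsto (fun a : ℝ => (x.2 : ℝ) + a) (𝓝[≠] 0) (𝓝[≠] (x.2 : ℝ)) := by
          refine tendsto_nhdsWithin_iff.2 ⟨?_, ?_⟩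
          · have : Continuous fun a : ℝ => (x.2 : ℝ) + a := by fun_prop
            simpa using (this.tendsto 0).mono_left nhdsWithin_le_nhds
          · filter_upwards [self_mem_nhdsWithin] with a ha
            simpa using ha
        filter_upwards [hlim.eventually (P.eventually_notMem_doublePoints x.1 x.2)] with a ha
        exact h _ _ ha
      have reg1 := fun x => (reg x).filter_mono (nhdsGT_le_nhdsNE (0 : ℝ))
      have reg2 := fun x => (reg x).filter_mono (nhdsLT_le_nhdsNE (0 : ℝ))
      obtain ⟨k₁, k₂, k₃, k₄, h1, h2, h3, h4, h5, h6, h7⟩ := exists_corner_values hF hxy hx hy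
      -- The first application compares corners across the strand of `x`, giving `k₁ = k₂` and `k₃ =
      -- k₄`. Exchanging the strands compares them across the strand of `y`, giving `k₁ = k₃`.
      obtain ⟨l₁, l₂, l₃, l₄, g1, g2, g3, g4, g5, g6, g7⟩ := exists_corner_values hF hxy.symm hy hx
      obtain ⟨_, e1, e1'⟩ := (h6.and (reg1 x)).exists
      obtain ⟨_, e2, e2'⟩ := (h7.and (reg2 x)).exists
      obtain ⟨_, e3, e3'⟩ := (g6.and (reg1 y)).exists
      obtain ⟨_, f1, f2⟩ := (h1.and g1).exists
      obtain ⟨_, f3, f4⟩ := (h3.and g2).exists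
      rw [add_comm (P.velocity x)] at f1
      rw [neg_add_eq_sub] at f3
      have k12 := e1.1 e1'
      have k34 := e2.1 e2'
      have l12 := e3.1 e3'
      have k13 : k₁ = k₃ := by rw [← f1.2, ← f3.2, f2.2, f4.2, l12]
      refine ⟨k₁, eventually_nhdsWithin_iff.2 ?_⟩
      filter_upwards [h5] with w hw hwS
      have := hw hwS
      rw [← k34, ← k13, ← k12] at this
      simpa using this
    · obtain ⟨i, t, rfl⟩ := Set.mem_iUnion.1 hz
      exact h i t hzd
  · refine ⟨F z, ?_⟩
    obtain ⟨ε, hε, hball⟩ := Metric.isOpen_iff.1 P.isOpen_compl_support z hz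
    refine eventually_nhdsWithin_of_eventually_nhds ?_
    filter_upwards [Metric.ball_mem_nhds z hε] with w hw
    exact hF _ hball (convex_ball _ _).isPreconnected _ hw _ (Metric.mem_ball_self hε)

end LinkProjection

/-! ### Colourings of the regions and their jumps modulo two -/

namespace LinkProjection

variable {n : ℕ} {P : LinkProjection n}

open Classical in
/-- The difference modulo two, at a regular point, of the values of `F` on both sides of the
curves. -/
noncomputable def jump (P : LinkProjection n) (F : ℂ → ZMod 2) (p : ℂ) : ZMod 2 :=
  if P.ConstNear F p then 0 else 1

/-- In `ZMod 2` the indicator of `k ≠ l` is `k + l`, which turns jumps into linear expressions in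
the colours. -/
theorem jump_eq_add {F : ℂ → ZMod 2} {p : ℂ} {k l : ZMod 2} (h : P.ConstNear F p ↔ k = l) :
    P.jump F p = k + l := by
  have key : ∀ k l : ZMod 2, (if k = l then (0 : ZMod 2) else 1) = k + l := by decide
  rw [jump, ← key]
  simp only [h]

theorem jump_congr {F G : ℂ → ZMod 2} (h : ∀ q ∈ P.supportᶜ, F q = G q) (p : ℂ) :
    P.jump F p = P.jump G p := by
  have : P.ConstNear F p ↔ P.ConstNear G p := by
    refine exists_congr fun k => eventually_congr ?_
    filter_upwards [self_mem_nhdsWithin] with q hq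
    rw [h q hq]
  classical
  rw [jump, jump]
  exact if_congr this rfl rfl

open Classical in
/-- The function on the plane defined by a colouring of the regions. -/
noncomputable def color (f : P.Region → ZMod 2) (q : ℂ) : ZMod 2 :=
  if h : q ∈ P.supportᶜ then f ⟨connectedComponentIn P.supportᶜ q, q, h, rfl⟩ else 0

/-- The region of a point. -/
def regionOf {q : ℂ} (hq : q ∈ P.supportᶜ) : P.Region :=
  ⟨connectedComponentIn P.supportᶜ q, q, hq, rfl⟩

theorem mem_regionOf {q : ℂ} (hq : q ∈ P.supportᶜ) : q ∈ (regionOf hq).1 :=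
  mem_connectedComponentIn hq

theorem Region.subset (R : P.Region) : R.1 ⊆ P.supportᶜ := by
  obtain ⟨_, q, hq, rfl⟩ := R
  exact connectedComponentIn_subset _ _

theorem Region.eq_regionOf {R : P.Region} {q : ℂ} (hq : q ∈ R.1) : R = regionOf (R.subset hq) := by
  refine Subtype.ext ?_
  obtain ⟨_, q', hq', rfl⟩ := R
  exact connectedComponentIn_eq hq

theorem color_apply (f : P.Region → ZMod 2) {q : ℂ} (hq : q ∈ P.supportᶜ) :
    color f q = f (regionOf hq) := dif_pos hq

theorem constOnRegions_color (f : P.Region → ZMod 2) : P.ConstOnRegions (color f) := by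
  intro A hA hAc x hx y hy
  rw [color_apply f (hA hx), color_apply f (hA hy)]
  congr 1
  exact Subtype.ext (P.constOnRegions_connectedComponentIn A hA hAc x hx y hy)

theorem exists_color_eq {F : ℂ → ZMod 2} (hF : P.ConstOnRegions F) :
    ∃ f : P.Region → ZMod 2, ∀ q ∈ P.supportᶜ, color f q = F q := by
  refine ⟨fun R => F R.2.choose, fun q hq => ?_⟩
  rw [color_apply _ hq]
  set R := regionOf hq with hR
  obtain ⟨hc, hc'⟩ := R.2.choose_spec
  refine hF R.1 R.subset ?_ _ ?_ _ (mem_regionOf hq)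
  · rw [hc']; exact isPreconnected_connectedComponentIn
  · have := mem_connectedComponentIn hc
    rwa [← hc'] at this

theorem corners_eq {x y : LinkParam n} {c : P.Crossing} (hxy : x ≠ y) (hx : P.point x = c.1)
    (hy : P.point y = c.1) :
    P.corners c = {P.velocity x + P.velocity y, P.velocity x - P.velocity y,
      -P.velocity x + P.velocity y, -P.velocity x - P.velocity y} := by
  ext d
  constructor
  · rintro ⟨x', y', hne, hx', hy', hd⟩
    have h1 := P.double x y x' hxy (hx.trans hy.symm) (hx'.trans hx.symm)
    have h2 := P.double x y y' hxy (hx.trans hy.symm) (hy'.trans hx.symm)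
    simp only [Set.mem_insert_iff, Set.mem_singleton_iff]
    rcases h1 with rfl | rfl <;> rcases h2 with rfl | rfl
    · exact absurd rfl hne
    · exact hd
    · rcases hd with hd | hd | hd | hd
      · left; rw [hd, add_comm]
      · right; right; left; rw [hd]; ring
      · right; left; rw [hd]; ring
      · right; right; right; rw [hd]; ring
    · exact absurd rfl hne
  · exact fun hd => ⟨x, y, hxy, hx, hy, hd⟩

/-- Transversality makes the four directions distinct, and each corner lies in exactly one region
because regions are disjoint. -/
theorem timesAround_eq_sum {x y : LinkParam n} {c : P.Crossing} (hxy : x ≠ y)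
    (hx : P.point x = c.1) (hy : P.point y = c.1) {R₁ R₂ R₃ R₄ : P.Region}
    (h1 : ∀ᶠ ε : ℝ in 𝓝[>] 0, c.1 + ε • (P.velocity x + P.velocity y) ∈ R₁.1)
    (h2 : ∀ᶠ ε : ℝ in 𝓝[>] 0, c.1 + ε • (P.velocity x - P.velocity y) ∈ R₂.1)
    (h3 : ∀ᶠ ε : ℝ in 𝓝[>] 0, c.1 + ε • (-P.velocity x + P.velocity y) ∈ R₃.1)
    (h4 : ∀ᶠ ε : ℝ in 𝓝[>] 0, c.1 + ε • (-P.velocity x - P.velocity y) ∈ R₄.1) [DecidableEq P.Region]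
    (R : P.Region) : P.timesAround R c =
      (if R = R₁ then 1 else 0) + (if R = R₂ then 1 else 0) + (if R = R₃ then 1 else 0) +
      (if R = R₄ then 1 else 0) := by
  have key : ∀ {d : ℂ} {R' : P.Region}, (∀ᶠ ε : ℝ in 𝓝[>] 0, c.1 + ε • d ∈ R'.1) →
      ((∀ᶠ ε : ℝ in 𝓝[>] 0, c.1 + ε • d ∈ R.1) ↔ R = R') := by
    intro d R' h
    constructor
    · intro h'
      obtain ⟨ε, hε, hε'⟩ := (h.and h').exists
      rw [Region.eq_regionOf hε, Region.eq_regionOf hε']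
    · rintro rfl
      exact h
  have hli := LinearIndependent.pair_iff.1 (P.transverse x y hxy (hx.trans hy.symm))
  change ∀ s t : ℝ, s • P.velocity x + t • P.velocity y = 0 → s = 0 ∧ t = 0 at hli
  classical
  have hcorners := corners_eq hxy hx hy
  set u := P.velocity x
  set v := P.velocity y
  have hu : u ≠ 0 := fun h => by simpa using (hli 1 0 (by simp [h])).1
  have hv : v ≠ 0 := fun h => by simpa using (hli 0 1 (by simp [h])).2
  have huv : u + v ≠ 0 := fun h => by simpa using (hli 1 1 (by simpa using h)).1
  have huv' : u - v ≠ 0 := fun h => by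
    simpa using (hli 1 (-1) (by simpa [sub_eq_add_neg] using h)).1
  have n12 : u + v ≠ u - v := fun h => hv (by linear_combination h / 2)
  have n13 : u + v ≠ -u + v := fun h => hu (by linear_combination h / 2)
  have n14 : u + v ≠ -u - v := fun h => huv (by linear_combination h / 2)
  have n23 : u - v ≠ -u + v := fun h => huv' (by linear_combination h / 2)
  have n24 : u - v ≠ -u - v := fun h => hu (by linear_combination h / 2)
  have n34 : -u + v ≠ -u - v := fun h => hv (by linear_combination h / 2)
  have hset : {d ∈ P.corners c | ∀ᶠ ε : ℝ in 𝓝[>] 0, c.1 + ε • d ∈ R.1} =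
      (({u + v, u - v, -u + v, -u - v} : Finset ℂ).filter
        fun d => ∀ᶠ ε : ℝ in 𝓝[>] 0, c.1 + ε • d ∈ R.1 : Set ℂ) := by
    ext d
    rw [hcorners]
    simp
  rw [timesAround, hset, Set.ncard_coe_finset, Finset.card_filter,
    Finset.sum_insert (by simp [n12, n13, n14]), Finset.sum_insert (by simp [n23, n24]),
    Finset.sum_insert (by simp [n34]), Finset.sum_singleton, ← add_assoc, ← add_assoc]
  simp only [key h1, key h2, key h3, key h4]

/-- The sum of the colours of the four corners at a crossing point is the sum of the jumps of the
colouring before and after the crossing point along one of the two strands. -/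
theorem exists_sum_mul_timesAround [Fintype P.Region] (f : P.Region → ZMod 2) {x y : LinkParam n}
    {c : P.Crossing} (hxy : x ≠ y) (hx : P.point x = c.1) (hy : P.point y = c.1) :
    ∃ j₁ j₂ : ZMod 2,
      (∀ᶠ a : ℝ in 𝓝[>] 0, P.jump (color f) (P.curve x.1 (x.2 + a)) = j₁) ∧
      (∀ᶠ a : ℝ in 𝓝[<] 0, P.jump (color f) (P.curve x.1 (x.2 + a)) = j₂) ∧
      ∑ R, f R * (P.timesAround R c : ZMod 2) = j₁ + j₂ := by
  classical
  obtain ⟨k₁, k₂, k₃, k₄, h1, h2, h3, h4, -, h6, h7⟩ :=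
    exists_corner_values (constOnRegions_color f) hxy hx hy
  obtain ⟨S₁, S₂, S₃, S₄, g1, g2, g3, g4, -⟩ :=
    exists_corner_values P.constOnRegions_connectedComponentIn hxy hx hy
  have region : ∀ {d : ℂ} {S : Set ℂ} {k : ZMod 2},
      (∀ᶠ ε : ℝ in 𝓝[>] 0, c.1 + ε • d ∈ P.supportᶜ ∧ color f (c.1 + ε • d) = k) →
      (∀ᶠ ε : ℝ in 𝓝[>] 0, c.1 + ε • d ∈ P.supportᶜ ∧
        connectedComponentIn P.supportᶜ (c.1 + ε • d) = S) →
      ∃ R : P.Region, (∀ᶠ ε : ℝ in 𝓝[>] 0, c.1 + ε • d ∈ R.1) ∧ f R = k := by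
    intro d S k h g
    obtain ⟨ε, hε, hε'⟩ := (h.and g).exists
    refine ⟨regionOf hε.1, ?_, by rw [← color_apply f hε.1, hε.2]⟩
    filter_upwards [g] with ε₁ h₁
    have : (regionOf hε.1).1 = connectedComponentIn P.supportᶜ (c.1 + ε₁ • d) := by
      rw [h₁.2, ← hε'.2]
      rfl
    rw [this]
    exact mem_connectedComponentIn h₁.1
  obtain ⟨R₁, r1, f1⟩ := region h1 g1
  obtain ⟨R₂, r2, f2⟩ := region h2 g2
  obtain ⟨R₃, r3, f3⟩ := region h3 g3
  obtain ⟨R₄, r4, f4⟩ := region h4 g4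
  -- `k₁` and `k₂` lie on the two sides of the outgoing half of the strand of `x`, `k₃` and `k₄` on
  -- those of the incoming half.
  refine ⟨k₁ + k₂, k₃ + k₄, h6.mono fun _ h => jump_eq_add h, h7.mono fun _ h => jump_eq_add h, ?_⟩
  simp only [timesAround_eq_sum hxy hx hy r1 r2 r3 r4, Nat.cast_add, Nat.cast_ite, Nat.cast_one,
    Nat.cast_zero, mul_add, mul_ite, mul_one, mul_zero, Finset.sum_add_distrib,
    Finset.sum_ite_eq', Finset.mem_univ, if_true, f1, f2, f3, f4]
  ring

theorem tendsto_coe_add_nhdsNE (s : ℝ) : Tendsto (fun a : ℝ => s + a) (𝓝[≠] 0) (𝓝[≠] s) := by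
  refine tendsto_nhdsWithin_iff.2 ⟨?_, ?_⟩
  · have : Continuous fun a : ℝ => s + a := by fun_prop
    simpa using (this.tendsto 0).mono_left nhdsWithin_le_nhds
  · filter_upwards [self_mem_nhdsWithin] with a ha
    simpa using ha

/-- If the colours sum to zero at every crossing point, the jump is the same at all the regular
points of a component. -/
theorem jump_eq_jump [Fintype P.Region] {f : P.Region → ZMod 2}
    (hf : ∀ c, ∑ R, f R * (P.timesAround R c : ZMod 2) = 0) {i : Fin n} {t s : ℝ}
    (ht : P.curve i t ∉ P.doublePoints) (hs : P.curve i s ∉ P.doublePoints) :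
    P.jump (color f) (P.curve i t) = P.jump (color f) (P.curve i s) := by
  have hD : ∀ t, {t | P.curve i t ∉ P.doublePoints} ∈ 𝓝[≠] t :=
    fun t => P.eventually_notMem_doublePoints i t
  refine eq_of_eventually_const (D := {t | P.curve i t ∉ P.doublePoints})
    (g := fun t => P.jump (color f) (P.curve i t)) (fun t => ?_) (fun t => ?_) ht hs
  · exact (inferInstance : (𝓝[≠] t).NeBot).mono
      (le_inf nhdsWithin_le_nhds (le_principal_iff.2 (hD t)))
  · by_cases h : P.curve i t ∈ P.doublePoints
    · obtain ⟨y, hy, hyx⟩ : ∃ y, P.point y = P.curve i t ∧ P.param i t ≠ y := by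
        obtain ⟨x, y, hxy, hx, hy⟩ := h
        by_cases hne : P.param i t = y
        · exact ⟨x, hx, fun h' => hxy (h'.symm.trans hne)⟩
        · exact ⟨y, hy, hne⟩
      obtain ⟨j₁, j₂, h1, h2, h3⟩ := exists_sum_mul_timesAround f (c := ⟨P.curve i t, h⟩) hyx
        (P.point_param i t) hy
      have hj : j₁ = j₂ := by
        have key : ∀ j₁ j₂ : ZMod 2, 0 = j₁ + j₂ → j₁ = j₂ := by decide
        exact key _ _ ((hf _).symm.trans h3)
      -- The jumps before and after the crossing agree, hence the jump is constant on a punctured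
      -- neighbourhood. `Int.fract t` appears because crossings are described by parameters in `[0,
      -- 1)`.
      have h12 : ∀ᶠ a : ℝ in 𝓝[≠] 0, P.jump (color f) (P.curve i (Int.fract t + a)) = j₁ := by
        rw [← nhdsLT_sup_nhdsGT, eventually_sup]
        exact ⟨hj ▸ h2, h1⟩
      have h12' : ∀ᶠ s in 𝓝[≠] t, P.jump (color f) (P.curve i s) = j₁ := by
        have hlim : Tendsto (fun s : ℝ => s - t) (𝓝[≠] t) (𝓝[≠] 0) := by
          refine tendsto_nhdsWithin_iff.2 ⟨?_, ?_⟩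
          · have : Continuous fun a : ℝ => a - t := by fun_prop
            simpa using (this.tendsto t).mono_left nhdsWithin_le_nhds
          · filter_upwards [self_mem_nhdsWithin] with a ha
            simpa [sub_eq_zero] using ha
        filter_upwards [hlim.eventually h12] with s hs
        rwa [curve_fract_add, add_sub_cancel] at hs
      refine ⟨j₁, h12'.filter_mono (nhdsWithin_mono t fun s hs => ?_)⟩
      rintro rfl
      exact hs h
    · obtain ⟨l, _, r, _, -, h2⟩ := exists_sides h
      exact ⟨_, eventually_nhdsWithin_of_eventually_nhds <|
        (h2 (constOnRegions_color f)).1.mono fun _ h => jump_eq_add h⟩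

/-! ### Winding numbers modulo two as colourings -/

section Loop

variable {i : Fin n} {a b : ℝ}

/-- The winding number modulo two of a part of a component. -/
noncomputable def winding (P : LinkProjection n) (i : Fin n) (a b : ℝ) (z : ℂ) : ZMod 2 :=
  windingNumber (P.curve i) a b z

theorem compl_support_subset (P : LinkProjection n) (i : Fin n) (a b : ℝ) :
    P.supportᶜ ⊆ (P.curve i '' Set.uIcc a b)ᶜ := by
  refine Set.compl_subset_compl.2 ?_
  rintro _ ⟨t, -, rfl⟩
  exact P.curve_mem_support i t

theorem constOnRegions_winding (hab : a ≤ b) (h : P.curve i a = P.curve i b) :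
    P.ConstOnRegions (P.winding i a b) := by
  intro A hA hAc x hx y hy
  rw [winding, winding, windingNumber_eq_of_isPreconnected (P.contDiff i) hab h hAc
    (hA.trans (P.compl_support_subset i a b)) hx hy]

theorem jump_winding_eq_zero (hab : a ≤ b) (h : P.curve i a = P.curve i b) {p : ℂ}
    (hp : p ∉ P.curve i '' Set.uIcc a b) : P.jump (P.winding i a b) p = 0 := by
  refine if_pos ⟨P.winding i a b p, eventually_nhdsWithin_of_eventually_nhds ?_⟩
  filter_upwards [eventually_windingNumber_eq (P.contDiff i) hab h hp] with q hq
  rw [winding, winding, hq]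

/-- Crossing the curve along the normal changes the integral by `2 π i` in the limit, so the winding
number by one. The bound `b ≤ a + 1` ensures that the loop passes only once through the regular
point. -/
theorem jump_winding_eq_one (h : P.curve i a = P.curve i b) (hb : b ≤ a + 1) {t : ℝ}
    (ht : t ∈ Set.Ioo a b) (hreg : P.curve i t ∉ P.doublePoints) :
    P.jump (P.winding i a b) (P.curve i t) = 1 := by
  have hab : a ≤ b := (ht.1.trans ht.2).le
  obtain ⟨l, _, r, _, hlr, -⟩ := exists_sides hreg
  have hinj : ∀ s ∈ Set.Icc a b, P.curve i s = P.curve i t → s = t := by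
    intro s hs hst
    obtain ⟨-, m, hm⟩ := param_eq_iff (P := P) |>.1 (param_eq_of_curve_eq hreg hst)
    have h1 : (m : ℝ) < 1 := by linarith [hs.1, ht.2]
    have h2 : (-1 : ℝ) < m := by linarith [hs.2, ht.1]
    have h3 : m < 1 := by exact_mod_cast h1
    have h4 : -1 < m := by exact_mod_cast h2
    have h5 : m = 0 := by omega
    rw [hm, h5, Int.cast_zero, add_zero]
  have hw := eventually_windingNumber_sub (k := 1) (P.contDiff i) hab h
    (hlr.mono fun _ h => P.compl_support_subset i a b h.1)
    (hlr.mono fun _ h => P.compl_support_subset i a b h.2)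
    (by simpa using tendsto_logIntegral_sub (P.contDiff i) ht (P.immersed i t) hinj)
  refine if_neg ?_
  rintro ⟨k, hk⟩
  rw [eventually_nhdsWithin_iff] at hk
  have hlim : ∀ d : ℂ, Tendsto (fun ε : ℝ => P.curve i t + ε • d) (𝓝[>] 0) (𝓝 (P.curve i t)) := by
    intro d
    have : Continuous fun ε : ℝ => P.curve i t + ε • d := by fun_prop
    simpa using (this.tendsto 0).mono_left nhdsWithin_le_nhds
  obtain ⟨ε, h1, h2, h3, h4⟩ := (hw.and (hlr.and (((hlim _).eventually hk).and
    ((hlim (-(Complex.I * deriv (P.curve i) t))).eventually hk)))).exists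
  rw [smul_neg, ← sub_eq_add_neg] at h4
  have e1 := h3 h2.1
  have e2 := h4 h2.2
  rw [winding] at e1 e2
  have := congrArg (Int.cast : ℤ → ZMod 2) h1
  rw [Int.cast_sub, e1, e2, sub_self, Int.cast_one] at this
  exact absurd this (by decide)

end Loop

end LinkProjection

namespace LinkProjection

variable {n : ℕ} {P : LinkProjection n}

theorem exists_regular_param (P : LinkProjection n) (i : Fin n) :
    ∃ t, P.curve i t ∉ P.doublePoints :=
  (P.eventually_notMem_doublePoints i 0).exists

/-- The base point can be moved so that a given parameter becomes interior to the interval of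
integration. -/
theorem winding_eq_winding (P : LinkProjection n) (i : Fin n) (a : ℝ) :
    P.winding i 0 1 = P.winding i a (a + 1) := by
  ext z
  rw [winding, winding, windingNumber_eq_of_periodic (P.periodic i)]

theorem constOnRegions_winding_component (P : LinkProjection n) (i : Fin n) :
    P.ConstOnRegions (P.winding i 0 1) :=
  constOnRegions_winding zero_le_one (by simpa using (P.periodic i 0).symm)

theorem jump_winding_component {i j : Fin n} {t : ℝ} (h : P.curve j t ∉ P.doublePoints) :
    P.jump (P.winding i 0 1) (P.curve j t) = if i = j then 1 else 0 := by
  split_ifs with hij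
  · subst hij
    rw [P.winding_eq_winding i (t - 1 / 2)]
    exact jump_winding_eq_one (P.periodic i _).symm le_rfl ⟨by linarith, by linarith⟩ h
  · refine jump_winding_eq_zero zero_le_one (by simpa using (P.periodic i 0).symm) ?_
    rintro ⟨s, -, hs⟩
    exact hij (P.param_eq_iff.1 (param_eq_of_curve_eq h hs)).1

/-- A colouring whose jumps on both sides of a crossing point have sum `k`, along one of the
strands, has corners with sum `k`. -/
theorem sum_mul_timesAround_eq [Fintype P.Region] {f : P.Region → ZMod 2} {x y : LinkParam n}
    {c : P.Crossing} (hxy : x ≠ y) (hx : P.point x = c.1) (hy : P.point y = c.1) {j₁ j₂ : ZMod 2}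
    (h1 : ∀ᶠ a : ℝ in 𝓝[>] 0, P.curve x.1 (x.2 + a) ∉ P.doublePoints →
      P.jump (color f) (P.curve x.1 (x.2 + a)) = j₁)
    (h2 : ∀ᶠ a : ℝ in 𝓝[<] 0, P.curve x.1 (x.2 + a) ∉ P.doublePoints →
      P.jump (color f) (P.curve x.1 (x.2 + a)) = j₂) :
    ∑ R, f R * (P.timesAround R c : ZMod 2) = j₁ + j₂ := by
  obtain ⟨k₁, k₂, g1, g2, hsum⟩ := exists_sum_mul_timesAround f hxy hx hy
  have hreg := (tendsto_coe_add_nhdsNE (x.2 : ℝ)).eventually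
    (P.eventually_notMem_doublePoints x.1 x.2)
  obtain ⟨_, e1, e2, e3⟩ := (h1.and (g1.and (hreg.filter_mono (nhdsGT_le_nhdsNE (0 : ℝ))))).exists
  obtain ⟨_, e4, e5, e6⟩ := (h2.and (g2.and (hreg.filter_mono (nhdsLT_le_nhdsNE (0 : ℝ))))).exists
  rw [hsum, ← e2, ← e5, e1 e3, e4 e6]

instance nonempty_region : Nonempty P.Region := by
  obtain ⟨q, hq⟩ := (P.nhdsWithin_compl_support_neBot 0).nonempty_of_mem self_mem_nhdsWithin
  exact ⟨regionOf hq⟩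

/-! ### Dimension of the left kernel and the rank -/

section Rank

variable [Fintype P.Region]

theorem mem_ker_mulVecLin {f : P.Region → ZMod 2} :
    f ∈ LinearMap.ker P.incidenceMatrix.transpose.mulVecLin ↔
      ∀ c, ∑ R, f R * (P.timesAround R c : ZMod 2) = 0 := by
  rw [LinearMap.mem_ker, funext_iff]
  refine forall_congr' fun c => ?_
  simp only [Matrix.mulVecLin_apply, Matrix.mulVec, dotProduct, Matrix.transpose_apply,
    incidenceMatrix, Matrix.of_apply, Pi.zero_apply]
  rw [Finset.sum_congr rfl fun R _ => mul_comm _ _]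

/-- Rank-nullity for the map that records the jump at one regular point of each component: its image
has dimension `n`, and its kernel is spanned by the constant colouring `1`. -/
theorem finrank_ker_mulVecLin :
    Module.finrank (ZMod 2) (LinearMap.ker P.incidenceMatrix.transpose.mulVecLin) = n + 1 := by
  set V := LinearMap.ker P.incidenceMatrix.transpose.mulVecLin with hV
  choose t ht using P.exists_regular_param
  choose l hl r hr _ hlr using fun i => exists_sides (ht i)
  have hjump : ∀ {F : ℂ → ZMod 2}, P.ConstOnRegions F → ∀ i,
      P.jump F (P.curve i (t i)) = F (l i) + F (r i) :=
    fun hF i => jump_eq_add (hlr i hF).1.self_of_nhds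
  let jumps : (P.Region → ZMod 2) →ₗ[ZMod 2] (Fin n → ZMod 2) := LinearMap.pi fun i =>
    LinearMap.proj (R := ZMod 2) (φ := fun _ : P.Region => ZMod 2) (regionOf (hl i)) +
      LinearMap.proj (regionOf (hr i))
  have hjumps : ∀ f i, jumps f i = P.jump (color f) (P.curve i (t i)) := fun f i => by
    rw [hjump (constOnRegions_color f), color_apply f (hl i), color_apply f (hr i)]
    rfl
  have hsurj : LinearMap.range (jumps.domRestrict V) = ⊤ := by
    rw [eq_top_iff, ← (Pi.basisFun (ZMod 2) (Fin n)).span_eq, Submodule.span_le]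
    rintro _ ⟨i, rfl⟩
    obtain ⟨f, hf⟩ := exists_color_eq (P.constOnRegions_winding_component i)
    have hfV : f ∈ V := by
      rw [hV, mem_ker_mulVecLin]
      intro c
      obtain ⟨x, y, hxy, hx, hy⟩ := c.2
      have hj : ∀ a : ℝ, P.curve x.1 (x.2 + a) ∉ P.doublePoints →
          P.jump (color f) (P.curve x.1 (x.2 + a)) = if i = x.1 then 1 else 0 := fun a ha => by
        rw [jump_congr hf, jump_winding_component ha]
      rw [sum_mul_timesAround_eq hxy hx hy (Eventually.of_forall hj) (Eventually.of_forall hj)]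
      exact CharTwo.add_self_eq_zero _
    refine ⟨⟨f, hfV⟩, ?_⟩
    ext j
    rw [LinearMap.domRestrict_apply, hjumps, jump_congr hf, jump_winding_component (ht j)]
    simp [Pi.single_apply, eq_comm]
  have hone : (1 : P.Region → ZMod 2) ∈ V := by
    rw [hV, mem_ker_mulVecLin]
    intro c
    obtain ⟨x, y, hxy, hx, hy⟩ := c.2
    have hj : ∀ a : ℝ, P.curve x.1 (x.2 + a) ∉ P.doublePoints →
        P.jump (color (1 : P.Region → ZMod 2)) (P.curve x.1 (x.2 + a)) = 0 := fun a _ => by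
      refine if_pos ⟨1, ?_⟩
      filter_upwards [self_mem_nhdsWithin] with q hq
      rw [color_apply _ hq, Pi.one_apply]
    rw [sum_mul_timesAround_eq hxy hx hy (Eventually.of_forall hj) (Eventually.of_forall hj),
      add_zero]
  have hker : Module.finrank (ZMod 2) (LinearMap.ker (jumps.domRestrict V)) = 1 := by
    have hone' : jumps 1 = 0 := by
      ext i
      change (1 : ZMod 2) + 1 = 0
      decide
    refine finrank_eq_one ⟨⟨1, hone⟩, hone'⟩ (fun h => ?_) ?_
    · have := congrArg (fun f => f.1.1 (Classical.arbitrary P.Region)) h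
      exact one_ne_zero this
    · rintro ⟨⟨f, hfV⟩, hf⟩
      refine ⟨f (Classical.arbitrary P.Region), Subtype.ext (Subtype.ext (funext fun R => ?_))⟩
      -- The jump vanishes at the chosen point of each component, hence at all its regular points,
      -- and a colouring without jumps is constant.
      have hnear : ∀ i s, P.curve i s ∉ P.doublePoints → P.ConstNear (color f) (P.curve i s) := by
        intro i s hs
        have h1 := jump_eq_jump (mem_ker_mulVecLin.1 hfV) hs (ht i)
        have h2 : jumps f i = 0 := congrFun (LinearMap.mem_ker.1 hf) i
        rw [← hjumps, h2] at h1
        by_contra hcon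
        rw [jump, if_neg hcon] at h1
        exact one_ne_zero h1
      have hval : ∀ R : P.Region, ∃ q, ∃ hq : q ∈ P.supportᶜ, R = regionOf hq := by
        rintro ⟨_, q, hq, rfl⟩
        exact ⟨q, hq, rfl⟩
      obtain ⟨q, hq, hqR⟩ := hval (Classical.arbitrary P.Region)
      obtain ⟨q', hq', rfl⟩ := hval R
      have := eq_of_constNear (constOnRegions_color f) hnear hq hq'
      rw [color_apply f hq, color_apply f hq', ← hqR] at this
      simp [this]
  have hrn := LinearMap.finrank_range_add_finrank_ker (jumps.domRestrict V)
  rw [hsurj, finrank_top, Module.finrank_fin_fun, hker] at hrn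
  exact hrn.symm

theorem rank_incidenceMatrix_add :
    P.incidenceMatrix.rank + (n + 1) = Nat.card P.Region := by
  have h := LinearMap.finrank_range_add_finrank_ker P.incidenceMatrix.transpose.mulVecLin
  rw [finrank_ker_mulVecLin, Module.finrank_fintype_fun_eq_card, ← Nat.card_eq_fintype_card] at h
  rw [← h, ← Matrix.rank_transpose]
  rfl

end Rank

/-! ### The loop at a crossing of a knot -/

/-- At a crossing point of a component with itself, a loop of this component based at the crossing
point gives a colouring of the regions for which the colours of the corners have sum one at this
crossing point and sum zero at the other ones. -/
theorem exists_sum_mul_timesAround_eq_ite {P : LinkProjection 1} [Fintype P.Region]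
    [DecidableEq P.Crossing] (c : P.Crossing) :
    ∃ f : P.Region → ZMod 2, ∀ c', ∑ R, f R * (P.timesAround R c' : ZMod 2) =
      if c' = c then 1 else 0 := by
  obtain ⟨x, y, hxy, hx, hy, hlt⟩ : ∃ x y : LinkParam 1, x ≠ y ∧ P.point x = c.1 ∧
      P.point y = c.1 ∧ (x.2 : ℝ) < y.2 := by
    obtain ⟨x, y, hxy, hx, hy⟩ := c.2
    have hne : (x.2 : ℝ) ≠ y.2 := fun h =>
      hxy (Prod.ext (Subsingleton.elim _ _) (Subtype.ext h))
    rcases lt_or_gt_of_ne hne with h | h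
    · exact ⟨x, y, hxy, hx, hy, h⟩
    · exact ⟨y, x, hxy.symm, hy, hx, h⟩
  obtain ⟨i, ⟨a, ha⟩⟩ := x
  obtain ⟨j, ⟨b, hb⟩⟩ := y
  obtain rfl := Subsingleton.elim i j
  change P.curve i a = c.1 at hx
  change P.curve i b = c.1 at hy
  change a < b at hlt
  have hab : P.curve i a = P.curve i b := hx.trans hy.symm
  have hba : b < a + 1 := by linarith [ha.1, hb.2]
  obtain ⟨f, hf⟩ := exists_color_eq (constOnRegions_winding hlt.le hab)
  have jump_one : ∀ s, s ∈ Set.Ioo a b → P.curve i s ∉ P.doublePoints →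
      P.jump (color f) (P.curve i s) = 1 := fun s hs hreg => by
    rw [jump_congr hf, jump_winding_eq_one hab hba.le hs hreg]
  -- The complementary loop is parametrised by `(b, a + 1)`; the shift by `m` brings parameters of
  -- `[0, a)` into this interval.
  have jump_zero : ∀ (s : ℝ) (m : ℤ), s + m ∈ Set.Ioo b (a + 1) → P.curve i s ∉ P.doublePoints →
      P.jump (color f) (P.curve i s) = 0 := fun s m hs hreg => by
    rw [jump_congr hf, jump_winding_eq_zero hlt.le hab]
    rintro ⟨s', hs', hss'⟩
    rw [Set.uIcc_of_le hlt.le] at hs'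
    obtain ⟨-, k, hk⟩ := P.param_eq_iff.1 (param_eq_of_curve_eq hreg hss')
    have h1 : ((0 : ℤ) : ℝ) < ((m + k : ℤ) : ℝ) := by push_cast; linarith [hs'.2, hs.1]
    have h2 : ((m + k : ℤ) : ℝ) < ((1 : ℤ) : ℝ) := by push_cast; linarith [hs'.1, hs.2]
    have h3 : 0 < m + k := Int.cast_lt.1 h1
    have h4 : m + k < 1 := Int.cast_lt.1 h2
    omega
  have near : ∀ (s : ℝ) (m : ℤ) {I : Set ℝ}, IsOpen I → s + m ∈ I →
      ∀ᶠ e : ℝ in 𝓝 0, s + e + m ∈ I := fun s m I hI hs => by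
    have hc : Continuous fun e : ℝ => s + e + m := by fun_prop
    exact hc.continuousAt.preimage_mem_nhds (hI.mem_nhds (by simpa using hs))
  refine ⟨f, fun c' => ?_⟩
  split_ifs with hc
  · subst hc
    -- At `c`, along the strand with parameter `a`, the curve enters the loop: the jump is one after
    -- `a` and zero before it.
    rw [← add_zero (1 : ZMod 2)]
    refine sum_mul_timesAround_eq hxy hx hy ?_ ?_
    · filter_upwards [Ioo_mem_nhdsGT (sub_pos.2 hlt)] with e he
      exact jump_one _ ⟨by linarith [he.1], by linarith [he.2]⟩
    · filter_upwards [Ioo_mem_nhdsLT (sub_neg.2 hba)] with e he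
      exact jump_zero (a + e) 1 ⟨by push_cast; linarith [he.1], by push_cast; linarith [he.2]⟩
  · obtain ⟨x', y', hxy', hx', hy'⟩ := c'.2
    obtain ⟨i', ⟨s, hs⟩⟩ := x'
    obtain rfl := Subsingleton.elim i i'
    change P.curve i s = c'.1 at hx'
    have hsa : s ≠ a := fun h => hc (Subtype.ext (by rw [← hx', ← hx, h]))
    have hsb : s ≠ b := fun h => hc (Subtype.ext (by rw [← hx', ← hy, h]))
    -- At another crossing a single strand suffices: near `s` it stays inside one of the two loops,
    -- so the same jump is counted twice.
    have both : ∀ {k : ZMod 2}, (∀ᶠ e : ℝ in 𝓝 0, P.curve i (s + e) ∉ P.doublePoints →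
        P.jump (color f) (P.curve i (s + e)) = k) →
        ∑ R, f R * (P.timesAround R c' : ZMod 2) = 0 := fun {k} h => by
      rw [sum_mul_timesAround_eq hxy' hx' hy' (eventually_nhdsWithin_of_eventually_nhds h)
        (eventually_nhdsWithin_of_eventually_nhds h)]
      exact CharTwo.add_self_eq_zero k
    have outside : ∀ m : ℤ, s + m ∈ Set.Ioo b (a + 1) →
        ∑ R, f R * (P.timesAround R c' : ZMod 2) = 0 := fun m hm =>
      both ((near s m isOpen_Ioo hm).mono fun e he => jump_zero _ m he)
    rcases lt_or_gt_of_ne hsa with h1 | h1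
    · exact outside 1 ⟨by push_cast; linarith [hs.1, hb.2], by push_cast; linarith⟩
    · rcases lt_or_gt_of_ne hsb with h2 | h2
      · refine both (k := 1) ?_
        filter_upwards [near s 0 isOpen_Ioo (I := Set.Ioo a b) ⟨by simpa using h1, by simpa using h2⟩]
          with e he
        exact jump_one _ (by simpa using he)
      · exact outside 0 ⟨by simpa using h2, by push_cast; linarith [hs.2, ha.1]⟩

end LinkProjection

/-! ### Sequences of region crossing changes as sums modulo two -/

namespace LinkDiagram

variable {n : ℕ}

theorem switch_empty (L : LinkDiagram n) : L.switch ∅ = L := by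
  simp [switch]

theorem switch_switch (L : LinkDiagram n) (S T : Set L.Crossing) :
    (L.switch S).switch T = L.switch (symmDiff S T) := by
  classical
  simp only [switch, mk.injEq, heq_eq_eq, true_and]
  constructor
  · ext1 c
    change (if c ∈ T then if c ∈ S then L.upper c else L.lower c else
      if c ∈ S then L.lower c else L.upper c) = _
    by_cases hS : c ∈ S <;> by_cases hT : c ∈ T <;> simp [Set.mem_symmDiff, hS, hT]
  · ext1 c
    change (if c ∈ T then if c ∈ S then L.lower c else L.upper c else
      if c ∈ S then L.upper c else L.lower c) = _
    by_cases hS : c ∈ S <;> by_cases hT : c ∈ T <;> simp [Set.mem_symmDiff, hS, hT]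

theorem reflTransGen_switch (L : LinkDiagram n) (A : Finset L.Region) :
    Relation.ReflTransGen
      (fun D D' : LinkDiagram n => ∃ R : D.Region, D' = D.regionCrossingChange R) L
      (L.switch {c | Odd (∑ R ∈ A, L.timesAround R c)}) := by
  classical
  induction A using Finset.induction_on with
  | empty => simpa [switch_empty] using Relation.ReflTransGen.refl
  | insert R A hR ih =>
    -- Switching keeps the projection, so `R` is still a region of the switched diagram and appears
    -- as often around each crossing.
    refine ih.tail ⟨R, ?_⟩
    refine Eq.trans ?_ (switch_switch L _ {c | Odd (L.timesAround R c)}).symm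
    congr 1
    ext c
    simp only [Finset.sum_insert hR, Set.mem_symmDiff, Set.mem_ofPred_eq, Nat.odd_add]
    rw [← Nat.not_odd_iff_even]
    tauto

/-- The changes are performed once on each region of colour one; the parity of the number of
switches at a crossing is then the sum of its corner colours. -/
theorem admissible_of_sum_eq (L : LinkDiagram n) [Fintype L.Region] {S : Set L.Crossing}
    [DecidablePred (· ∈ S)] {f : L.Region → ZMod 2}
    (hf : ∀ c, ∑ R, f R * (L.timesAround R c : ZMod 2) = if c ∈ S then 1 else 0) :
    L.Admissible S := by
  classical
  have hS : S = {c | Odd (∑ R ∈ Finset.univ.filter fun R => f R = 1, L.timesAround R c)} := by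
    ext c
    have hterm : ∀ (k m : ZMod 2), k * m = if k = 1 then m else 0 := by decide
    have h := hf c
    rw [Finset.sum_congr rfl fun R _ => hterm _ _, ← Finset.sum_filter, ← Nat.cast_sum] at h
    rw [Set.mem_ofPred_eq, ← ZMod.natCast_eq_one_iff_odd, h]
    split_ifs with hc <;> simp [hc]
  rw [Admissible, hS]
  exact reflTransGen_switch L _

end LinkDiagram

theorem corollary3 :
    (∀ (n : ℕ) (L : LinkDiagram n), Finite L.Region ∧
      (L.incidenceMatrix.rank : ℤ) = (Nat.card L.Region : ℤ) - (n : ℤ) - 1) ∧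
    (∀ (K : LinkDiagram 1) (c : K.Crossing), K.Admissible {c}) := by
  classical
  refine ⟨fun n L => ⟨inferInstance, ?_⟩, fun K c => ?_⟩
  · have := Fintype.ofFinite L.Region
    have := LinkProjection.rank_incidenceMatrix_add (P := L.toLinkProjection)
    omega
  · have := Fintype.ofFinite K.Region
    obtain ⟨f, hf⟩ := LinkProjection.exists_sum_mul_timesAround_eq_ite c
    exact K.admissible_of_sum_eq (f := f) fun c' => by simpa using hf c'
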